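/- Let $k$ be a field of characteristic zero. Let $\mathbf{FI}$ be the category of finite sets and injections and $\mathbf\Sigma$ its subcategory of finite sets and bijections. *The Koszul complex.* For an $\mathbf{FI}$-module $F$, the Koszul complex $\mathfrak{Kz}_\bullet F$ (which computes the $\mathbf{FI}$-homology of $F$) is the complex of $\mathbf\Sigma$-modules $$\mathfrak{Kz}_n F(X)=\bigoplus_{A\subset X,\ |A|=n}\Lambda^n(kA)\otimes F(X\setminus A),$$ with the evident action of bijections and with differential $\mathfrak{Kz}_{n+1}F\to\mathfrak{Kz}_nF$ sending $(x_0\wedge\dots\wedge x_n)\otimes y$, for $A=\{x_0,\dots,x_n\}$, to $$\sum_{i=0}^n(-1)^{n-i}(x_0\wedge\dots\widehat{x_i}\dots\wedge x_n)\otimes F(X\setminus A\subset (X\setminus A)\cup\{x_i\})(y).$$ For a finite set $B$ let $k\hom_{\mathbf{FI}}(-,B)^{\mathrm{tr}}$ be the $\mathbf{FI}$-module $X\mapsto k\hom_{\mathbf{FI}}(X,B)$ on which an injection $i:X\hookrightarrow Y$ acts by $[f]\mapsto\sum_{f'\circ i=f}[f']$, the sum being over injections $f':Y\hookrightarrow B$.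 It is functorial in $B\in\mathbf\Sigma$ by postcomposition. Write $\mathfrak{Kz}_\bullet k\hom_{\mathbf{FI}}(-,-)$ for the complex $(X,B)\mapsto\mathfrak{Kz}_\bullet\big(k\hom_{\mathbf{FI}}(-,B)^{\mathrm{tr}}\big)(X)$ of functors on $\mathbf\Sigma\times\mathbf\Sigma$. *Schur bifunctors.* For a functor $M$ from $\mathbf\Sigma\times\mathbf\Sigma$ to $k$-vector spaces and finite-dimensional $k$-vector spaces $V,W$, put $$M(V,W)=\bigoplus_{a,b\in\mathbb N}W^{\otimes b}\otimes_{\mathfrak S_b}M(\mathbf a,\mathbf b)\otimes_{\mathfrak S_a}V^{\otimes a};$$ the $(a,b)$ summand is its part of polynomial bidegree $(a,b)$. Applying this termwise gives a complex $\mathfrak{Kz}_\bullet k\hom_{\mathbf{FI}}(-,-)(V,W)$, natural in $(V,W)$. *The explicit complex.* Let $(S^*(W)\otimes\Lambda^*(V)\otimes S^*(W\otimes V),d)$ be the complex whose term in homological degree $n$ is $S^*(W)\otimes\Lambda^n(V)\otimes S^*(W\otimes V)$, with part of polynomial bidegree $(a,b)$ equal to $S^{b-a+n}(W)\otimes\Lambda^n(V)\otimes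 S^{a-n}(W\otimes V)$ (zero unless $n\le a\le b+n$), and whose differential is, in bidegree $(a,b)$, the composite $$S^{b-a+n+1}(W)\otimes\Lambda^{n+1}(V)\otimes S^{a-n-1}(W\otimes V)\to S^{b-a+n}(W)\otimes\Lambda^n(V)\otimes(W\otimes V)\otimes S^{a-n-1}(W\otimes V)\to S^{b-a+n}(W)\otimes\Lambda^n(V)\otimes S^{a-n}(W\otimes V).$$ Here the first map is induced by the coproduct components $S^*(W)\to S^{*-1}(W)\otimes W$, $w_1\cdots w_m\mapsto\sum_i w_1\cdots\widehat{w_i}\cdots w_m\otimes w_i$, and $\Lambda^{n+1}(V)\to\Lambda^n(V)\otimes V$, $v_0\wedge\dots\wedge v_n\mapsto\sum_i(-1)^{n-i}v_0\wedge\dots\widehat{v_i}\dots\wedge v_n\otimes v_i$, and the second map is the product of $S^*(W\otimes V)$. **Theorem.** There is an isomorphism of chain complexes $$\big(\mathfrak{Kz}_\bullet k\hom_{\mathbf{FI}}(-,-)(V,W),d\big)\;\cong\;\big(S^*(W)\otimes\Lambda^*(V)\otimes S^*(W\otimes V),d\big),$$ natural in the finite-dimensional vector spaces $V$ and $W$,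 which identifies the parts of each polynomial bidegree $(a,b)$. The differential of the right-hand side is linear over $S^*(W\otimes V)$, acting by multiplication on the last factor, so that the right-hand side is a complex of $S^*(W\otimes V)$-modules. Consequently, each homology space of $\mathfrak{Kz}_\bullet k\hom_{\mathbf{FI}}(-,-)(V,W)$ is an $S^*(W\otimes V)$-module (compatibly with its $k$-vector space structure), the action being induced through the isomorphism by the action on $S^*(W)\otimes\Lambda^*(V)\otimes S^*(W\otimes V)$. -/

import Mathlib

open CategoryTheory
open scoped TensorProduct DirectSum

universe u

noncomputable section

namespace FIKoszul

section Coproducts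

variable (k : Type u) [CommRing k] (V W : Type u) [AddCommGroup V] [Module k V]
  [AddCommGroup W] [Module k W]

/-- The projection `S^*(W) → S^1(W) = W` onto polynomial degree one. -/
def symProjOne : SymmetricAlgebra k W →ₗ[k] W :=
  letI : Module kᵐᵒᵖ W := Module.compHom _ ((RingHom.id k).fromOpposite mul_comm)
  haveI : IsCentralScalar k W := ⟨fun _ _ => rfl⟩
  TrivSqZeroExt.sndHom k W ∘ₗ
    (SymmetricAlgebra.lift (TrivSqZeroExt.inrHom k W) :
      SymmetricAlgebra k W →ₐ[k] TrivSqZeroExt k W).toLinearMap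

/-- The component `S^*(W) → S^{*-1}(W) ⊗ W` of the coproduct of the symmetric algebra; it sends
`w₁ ⋯ wₘ` to `∑ i, w₁ ⋯ ŵᵢ ⋯ wₘ ⊗ wᵢ`. -/
def symCoprod : SymmetricAlgebra k W →ₗ[k] SymmetricAlgebra k W ⊗[k] W :=
  (symProjOne k W).lTensor (SymmetricAlgebra k W) ∘ₗ
    (Coalgebra.comul (R := k) (A := SymmetricAlgebra k W))

/-- The exterior power `Λ^n(V)`; a copy of `⋀[k]^n V` on which instances are found quickly. -/
def ExtPow (n : ℕ) : Type u := ⋀[k]^n V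

instance (n : ℕ) : AddCommGroup (ExtPow k V n) := inferInstanceAs (AddCommGroup (⋀[k]^n V))

instance (n : ℕ) : Module k (ExtPow k V n) := inferInstanceAs (Module k (⋀[k]^n V))

/-- The universal alternating map `(v₁, …, vₙ) ↦ v₁ ∧ ⋯ ∧ vₙ`. -/
def wedge (n : ℕ) : V [⋀^Fin n]→ₗ[k] ExtPow k V n := exteriorPower.ιMulti k n

variable {V} in
/-- The linear map on `Λ^n(V)` given by an alternating map. -/
def extLift {n : ℕ} {N : Type*} [AddCommGroup N] [Module k N] (f : V [⋀^Fin n]→ₗ[k] N) :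
    ExtPow k V n →ₗ[k] N :=
  exteriorPower.alternatingMapLinearEquiv (R := k) (M := V) (N := N) f

variable {k V} in
/-- The functoriality of `Λ^n`. -/
def extMap {V' : Type u} [AddCommGroup V'] [Module k V'] (n : ℕ) (f : V →ₗ[k] V') :
    ExtPow k V n →ₗ[k] ExtPow k V' n :=
  exteriorPower.map n f

/-- The component `Λ^{n+1}(V) → Λ^n(V) ⊗ V` of the coproduct of the exterior algebra; it sends
`v₀ ∧ ⋯ ∧ vₙ` to `∑ i, (-1)^(n-i) v₀ ∧ ⋯ v̂ᵢ ⋯ ∧ vₙ ⊗ vᵢ`. -/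
def extCoprod (n : ℕ) : ExtPow k V (n + 1) →ₗ[k] ExtPow k V n ⊗[k] V :=
  (-1 : k) ^ n • extLift k
    (AlternatingMap.alternatizeUncurryFin (R := k) (M := V) (N := ExtPow k V n ⊗[k] V)
      { toFun := fun v => ((TensorProduct.mk k (ExtPow k V n) V).flip v).compAlternatingMap
          (wedge k V n)
        map_add' := fun v w => by ext; simp
        map_smul' := fun c v => by ext; simp })

variable {k V W}

theorem symProjOne_one : symProjOne k W 1 = 0 := by
  let : Module kᵐᵒᵖ W := Module.compHom _ ((RingHom.id k).fromOpposite mul_comm)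
  have : IsCentralScalar k W := ⟨fun _ _ => rfl⟩
  change TrivSqZeroExt.snd (SymmetricAlgebra.lift (TrivSqZeroExt.inrHom k W) 1) = 0
  rw [map_one, TrivSqZeroExt.snd_one]

theorem symProjOne_ι_mul (w : W) (s : SymmetricAlgebra k W) :
    symProjOne k W (SymmetricAlgebra.ι k W w * s) = SymmetricAlgebra.algebraMapInv s • w := by
  let : Module kᵐᵒᵖ W := Module.compHom _ ((RingHom.id k).fromOpposite mul_comm)
  have : IsCentralScalar k W := ⟨fun _ _ => rfl⟩
  have h : (TrivSqZeroExt.fstHom k k W).comp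
      (SymmetricAlgebra.lift (TrivSqZeroExt.inrHom k W)) =
        (SymmetricAlgebra.algebraMapInv : SymmetricAlgebra k W →ₐ[k] k) := by
    ext; simp [SymmetricAlgebra.algebraMapInv_ι]
  have h' := DFunLike.congr_fun h s
  simp at h'
  simp [symProjOne, h']

theorem symCoprod_one : symCoprod k W 1 = 0 := by
  simp [symCoprod, Algebra.TensorProduct.one_def, symProjOne_one]

theorem symCoprod_ι_mul (w : W) (s : SymmetricAlgebra k W) :
    symCoprod k W (SymmetricAlgebra.ι k W w * s) =
      (LinearMap.mulLeft k (SymmetricAlgebra.ι k W w)).rTensor W (symCoprod k W s) + s ⊗ₜ w := by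
  have key : ∀ z : SymmetricAlgebra k W ⊗[k] SymmetricAlgebra k W,
      (symProjOne k W).lTensor (SymmetricAlgebra k W)
        ((SymmetricAlgebra.ι k W w ⊗ₜ[k] 1 + 1 ⊗ₜ[k] SymmetricAlgebra.ι k W w) * z) =
      (LinearMap.mulLeft k (SymmetricAlgebra.ι k W w)).rTensor W
        ((symProjOne k W).lTensor (SymmetricAlgebra k W) z) +
      (TensorProduct.rid k _ ((SymmetricAlgebra.algebraMapInv (R := k) (M := W)).toLinearMap.lTensor
        (SymmetricAlgebra k W) z)) ⊗ₜ w := by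
    intro z
    induction z with
    | zero => simp
    | add x y hx hy => rw [mul_add, map_add, hx, hy]; simp [TensorProduct.add_tmul]; abel
    | tmul x y => simp [add_mul, symProjOne_ι_mul, TensorProduct.smul_tmul']
  have h2 := Coalgebra.lTensor_counit_comul (R := k) s
  have h3 : (Coalgebra.counit : SymmetricAlgebra k W →ₗ[k] k) =
    (SymmetricAlgebra.algebraMapInv (R := k) (M := W)).toLinearMap := rfl
  rw [h3] at h2
  simp only [symCoprod, LinearMap.comp_apply, Bialgebra.comul_mul, SymmetricAlgebra.comul_ι]
  rw [key, h2]
  simp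

/-- Induction on products of generators. -/
theorem sym_induction {P : SymmetricAlgebra k W → Prop} (one : P 1)
    (add : ∀ s t, P s → P t → P (s + t)) (smul : ∀ (c : k) s, P s → P (c • s))
    (mul : ∀ w s, P s → P (SymmetricAlgebra.ι k W w * s)) (s : SymmetricAlgebra k W) : P s := by
  suffices h : ∀ t, P t → P (s * t) by simpa using h 1 one
  induction s using SymmetricAlgebra.induction with
  | algebraMap r => intro t ht; rw [← Algebra.smul_def]; exact smul _ _ ht
  | ι w => exact fun t => mul w t
  | mul a b ha hb => intro t ht; rw [mul_assoc]; exact ha _ (hb _ ht)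
  | add a b ha hb => intro t ht; rw [add_mul]; exact add _ _ (ha _ ht) (hb _ ht)

/-- The iterated coproduct of the symmetric algebra is symmetric. -/
theorem symCoprod_symCoprod (s : SymmetricAlgebra k W) :
    TensorProduct.rightComm k (SymmetricAlgebra k W) W W
      ((symCoprod k W).rTensor W (symCoprod k W s)) =
    (symCoprod k W).rTensor W (symCoprod k W s) := by
  induction s using sym_induction with
  | one => simp [symCoprod_one]
  | add s t hs ht => simp only [map_add, hs, ht]
  | smul c s hs => simp only [map_smul, hs]
  | mul w s hs =>
    have key : ∀ z : SymmetricAlgebra k W ⊗[k] W,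
        (symCoprod k W).rTensor W
          ((LinearMap.mulLeft k (SymmetricAlgebra.ι k W w)).rTensor W z) =
        ((LinearMap.mulLeft k (SymmetricAlgebra.ι k W w)).rTensor W).rTensor W
          ((symCoprod k W).rTensor W z) +
        TensorProduct.rightComm k (SymmetricAlgebra k W) W W (z ⊗ₜ w) := by
      intro z
      induction z with
      | zero => simp
      | add x y hx hy => simp only [map_add, hx, hy, TensorProduct.add_tmul]; abel
      | tmul x y => simp [symCoprod_ι_mul, TensorProduct.add_tmul]
    have key2 : ∀ z : (SymmetricAlgebra k W ⊗[k] W) ⊗[k] W,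
        TensorProduct.rightComm k (SymmetricAlgebra k W) W W
        (((LinearMap.mulLeft k (SymmetricAlgebra.ι k W w)).rTensor W).rTensor W z) =
        ((LinearMap.mulLeft k (SymmetricAlgebra.ι k W w)).rTensor W).rTensor W
        (TensorProduct.rightComm k (SymmetricAlgebra k W) W W z) := by
      intro z
      induction z with
      | zero => simp
      | add x y hx hy => simp only [map_add, hx, hy]
      | tmul x y =>
        induction x with
        | zero => simp
        | add x y hx hy => simp only [map_add, hx, hy, TensorProduct.add_tmul]
        | tmul x y => simp
    have key3 : ∀ z : (SymmetricAlgebra k W ⊗[k] W) ⊗[k] W,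
        TensorProduct.rightComm k (SymmetricAlgebra k W) W W
        (TensorProduct.rightComm k (SymmetricAlgebra k W) W W z) = z := by
      intro z
      induction z with
      | zero => simp
      | add x y hx hy => simp only [map_add, hx, hy]
      | tmul x y =>
        induction x with
        | zero => simp
        | add x y hx hy => simp only [map_add, hx, hy, TensorProduct.add_tmul]
        | tmul x y => simp
    simp only [symCoprod_ι_mul, map_add, key, LinearMap.rTensor_tmul, key2, key3, hs]
    abel

theorem ext_wedge {n : ℕ} {N : Type*} [AddCommGroup N] [Module k N] {f g : ExtPow k V n →ₗ[k] N}
    (h : ∀ v, f (wedge k V n v) = g (wedge k V n v)) : f = g :=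
  exteriorPower.linearMap_ext (R := k) (N := N) (AlternatingMap.ext h)

theorem extLift_wedge {n : ℕ} {N : Type*} [AddCommGroup N] [Module k N] (f : V [⋀^Fin n]→ₗ[k] N)
    (v : Fin n → V) : extLift k f (wedge k V n v) = f v :=
  exteriorPower.alternatingMapLinearEquiv_apply_ιMulti f v

theorem extMap_wedge {V' : Type u} [AddCommGroup V'] [Module k V'] {n : ℕ} (f : V →ₗ[k] V')
    (v : Fin n → V) : extMap n f (wedge k V n v) = wedge k V' n (f ∘ v) :=
  exteriorPower.map_apply_ιMulti f v

theorem extMap_id (n : ℕ) : extMap n (LinearMap.id : V →ₗ[k] V) = LinearMap.id :=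
  exteriorPower.map_id

theorem extMap_comp {V' V'' : Type u} [AddCommGroup V'] [Module k V'] [AddCommGroup V'']
    [Module k V''] (n : ℕ) (g : V' →ₗ[k] V'') (f : V →ₗ[k] V') :
    extMap n (g ∘ₗ f) = extMap n g ∘ₗ extMap n f :=
  ext_wedge fun v => by simp only [LinearMap.comp_apply, extMap_wedge]; rfl

theorem neg_one_zsmul {N : Type*} [AddCommGroup N] [Module k N] (i : ℕ) (x : N) :
    (-1 : ℤ) ^ i • x = (-1 : k) ^ i • x := by
  rw [← Int.cast_smul_eq_zsmul k]; simp

theorem extCoprod_wedge (n : ℕ) (v : Fin (n + 1) → V) :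
    extCoprod k V n (wedge k V (n + 1) v) =
      (-1 : k) ^ n • ∑ i : Fin (n + 1), (-1 : k) ^ (i : ℕ) •
        (wedge k V n (i.removeNth v) ⊗ₜ[k] v i) := by
  simp [extCoprod, extLift_wedge, AlternatingMap.alternatizeUncurryFin_apply,
    ← neg_one_zsmul (k := k)]

/-- The iterated coproduct of the exterior algebra is antisymmetric. -/
theorem extCoprod_extCoprod (n : ℕ) {N : Type*} [AddCommGroup N] [Module k N]
    (g : (ExtPow k V n ⊗[k] V) ⊗[k] V →ₗ[k] N)
    (hg : ∀ ω v w, g ((ω ⊗ₜ v) ⊗ₜ w) = g ((ω ⊗ₜ w) ⊗ₜ v)) (ω : ExtPow k V (n + 2)) :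
    g ((extCoprod k V n).rTensor V (extCoprod k V (n + 1) ω)) = 0 := by
  let f : V →ₗ[k] V →ₗ[k] V [⋀^Fin n]→ₗ[k] N :=
    LinearMap.mk₂ k (fun v w => (g ∘ₗ (TensorProduct.mk k _ V).flip v ∘ₗ
      (TensorProduct.mk k (ExtPow k V n) V).flip w).compAlternatingMap (wedge k V n))
      (fun _ _ _ => by ext; simp)
      (fun _ _ _ => by ext; simp)
      (fun _ _ _ => by ext; simp)
      (fun _ _ _ => by ext; simp)
  have hf := AlternatingMap.alternatizeUncurryFin_alternatizeUncurryFinLM_comp_of_symmetric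
    (f := f) (fun v w => by ext x; simp [f, hg])
  suffices h : g ∘ₗ (extCoprod k V n).rTensor V ∘ₗ extCoprod k V (n + 1) = 0 from
    DFunLike.congr_fun h ω
  refine ext_wedge fun v => ?_
  have hv := DFunLike.congr_fun hf v
  simp only [AlternatingMap.alternatizeUncurryFin_apply, LinearMap.comp_apply,
    AlternatingMap.alternatizeUncurryFinLM_apply, AlternatingMap.zero_apply] at hv
  simp only [LinearMap.comp_apply, extCoprod_wedge, map_smul, LinearMap.rTensor_tmul,
    map_sum, TensorProduct.sum_tmul, LinearMap.zero_apply, ← TensorProduct.smul_tmul']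
  simp only [f, LinearMap.mk₂_apply, LinearMap.compAlternatingMap_apply, LinearMap.comp_apply,
    LinearMap.flip_apply, TensorProduct.mk_apply, neg_one_zsmul (k := k)] at hv
  simp only [smul_comm _ ((-1 : k) ^ n), ← Finset.smul_sum]
  rw [hv]
  simp

/-- The coproduct of the exterior algebra is natural. -/
theorem extCoprod_map (n : ℕ) {V' : Type u} [AddCommGroup V'] [Module k V'] (f : V →ₗ[k] V')
    (ω : ExtPow k V (n + 1)) :
    extCoprod k V' n (extMap (n + 1) f ω) =
      TensorProduct.map (extMap n f) f (extCoprod k V n ω) := by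
  suffices h : extCoprod k V' n ∘ₗ extMap (n + 1) f =
      TensorProduct.map (extMap n f) f ∘ₗ extCoprod k V n from DFunLike.congr_fun h ω
  refine ext_wedge fun v => ?_
  simp only [LinearMap.comp_apply, extMap_wedge, extCoprod_wedge, map_smul,
    map_sum, TensorProduct.map_tmul]
  rfl

end Coproducts

section Target

variable (k : Type u) [CommRing k] (V W : Type u) [AddCommGroup V] [Module k V]
  [AddCommGroup W] [Module k W]

/-- The reordering of tensor factors
`(S ⊗ W) ⊗ ((L ⊗ V) ⊗ T) ≅ S ⊗ (L ⊗ ((W ⊗ V) ⊗ T))`. -/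
def regroup (S L T : Type u) [AddCommGroup S] [Module k S] [AddCommGroup L] [Module k L]
    [AddCommGroup T] [Module k T] :
    (S ⊗[k] W) ⊗[k] ((L ⊗[k] V) ⊗[k] T) ≃ₗ[k] S ⊗[k] (L ⊗[k] ((W ⊗[k] V) ⊗[k] T)) :=
  TensorProduct.assoc k S W ((L ⊗[k] V) ⊗[k] T) ≪≫ₗ
    LinearEquiv.lTensor S
      (LinearEquiv.lTensor W (TensorProduct.assoc k L V T) ≪≫ₗ
        TensorProduct.leftComm k W L (V ⊗[k] T) ≪≫ₗ
        LinearEquiv.lTensor L (TensorProduct.assoc k W V T).symm)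

/-- The product `(W ⊗ V) ⊗ S^*(W ⊗ V) → S^*(W ⊗ V)`. -/
def symMul : (W ⊗[k] V) ⊗[k] SymmetricAlgebra k (W ⊗[k] V) →ₗ[k]
    SymmetricAlgebra k (W ⊗[k] V) :=
  LinearMap.mul' k (SymmetricAlgebra k (W ⊗[k] V)) ∘ₗ
    (SymmetricAlgebra.ι k (W ⊗[k] V)).rTensor (SymmetricAlgebra k (W ⊗[k] V))

/-- `(s ⊗ w) ⊗ ((l ⊗ v) ⊗ p) ↦ s ⊗ (l ⊗ (w ⊗ v) p)`, for `p` in `S^*(W ⊗ V)`. -/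
def regroupMul (S L : Type u) [AddCommGroup S] [Module k S] [AddCommGroup L] [Module k L] :
    (S ⊗[k] W) ⊗[k] ((L ⊗[k] V) ⊗[k] SymmetricAlgebra k (W ⊗[k] V)) →ₗ[k]
      S ⊗[k] (L ⊗[k] SymmetricAlgebra k (W ⊗[k] V)) :=
  ((symMul k V W).lTensor L).lTensor S ∘ₗ
    (regroup k V W S L (SymmetricAlgebra k (W ⊗[k] V))).toLinearMap

/-- The term `S^*(W) ⊗ Λ^n(V) ⊗ S^*(W ⊗ V)`, in homological degree `n`. -/
def SymExtTerm (n : ℕ) : Type u :=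
  SymmetricAlgebra k W ⊗[k] (ExtPow k V n ⊗[k] SymmetricAlgebra k (W ⊗[k] V))

instance (n : ℕ) : AddCommGroup (SymExtTerm k V W n) :=
  inferInstanceAs (AddCommGroup (_ ⊗[k] _))

instance (n : ℕ) : Module k (SymExtTerm k V W n) :=
  inferInstanceAs (Module k (_ ⊗[k] _))

/-- The Koszul-type differential: apply the two coproducts,
`S^*(W) ⊗ Λ^{n+1}(V) ⊗ S^*(W ⊗ V) → S^{*-1}(W) ⊗ Λ^n(V) ⊗ (W ⊗ V) ⊗ S^*(W ⊗ V)`,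
and then the product of `S^*(W ⊗ V)`. -/
def symExtD (n : ℕ) : SymExtTerm k V W (n + 1) →ₗ[k] SymExtTerm k V W n :=
  regroupMul k V W (SymmetricAlgebra k W) (ExtPow k V n) ∘ₗ
    TensorProduct.map (symCoprod k W)
      ((extCoprod k V n).rTensor (SymmetricAlgebra k (W ⊗[k] V)))

/-- The action of `S^*(W ⊗ V)` by multiplication on the third tensor factor. -/
def symAction (n : ℕ) :
    SymmetricAlgebra k (W ⊗[k] V) →ₐ[k] Module.End k (SymExtTerm k V W n) :=
  (Module.End.lTensorAlgHom k (ExtPow k V n ⊗[k] SymmetricAlgebra k (W ⊗[k] V))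
      (SymmetricAlgebra k W)).comp
    ((Module.End.lTensorAlgHom k (SymmetricAlgebra k (W ⊗[k] V)) (ExtPow k V n)).comp
      (Algebra.lmul k (SymmetricAlgebra k (W ⊗[k] V))))

instance (n : ℕ) : Module (SymmetricAlgebra k (W ⊗[k] V)) (SymExtTerm k V W n) :=
  Module.compHom _ (symAction k V W n).toRingHom

instance (n : ℕ) : IsScalarTower k (SymmetricAlgebra k (W ⊗[k] V)) (SymExtTerm k V W n) where
  smul_assoc c s x := DFunLike.congr_fun (map_smul (symAction k V W n) c s) x

variable {k V W}

theorem regroupMul_tmul {S L : Type u} [AddCommGroup S] [Module k S] [AddCommGroup L] [Module k L]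
    (s : S) (w : W) (l : L) (v : V) (p : SymmetricAlgebra k (W ⊗[k] V)) :
    regroupMul k V W S L ((s ⊗ₜ w) ⊗ₜ ((l ⊗ₜ v) ⊗ₜ p)) =
      s ⊗ₜ (l ⊗ₜ (SymmetricAlgebra.ι k _ (w ⊗ₜ v) * p)) := by
  simp [regroupMul, regroup, symMul]

theorem regroupMul_map {S L S' L' : Type u} [AddCommGroup S] [Module k S] [AddCommGroup L]
    [Module k L] [AddCommGroup S'] [Module k S'] [AddCommGroup L'] [Module k L']
    (f : S →ₗ[k] S') (g : L →ₗ[k] L') :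
    regroupMul k V W S' L' ∘ₗ TensorProduct.map (f.rTensor W) ((g.rTensor V).rTensor _) =
      TensorProduct.map f (g.rTensor _) ∘ₗ regroupMul k V W S L := by
  ext s w l v p
  simp [regroupMul_tmul]

theorem regroupMul_swap {S L : Type u} [AddCommGroup S] [Module k S] [AddCommGroup L] [Module k L]
    (x : (S ⊗[k] W) ⊗[k] W) (l : L) (v v' : V) (p : SymmetricAlgebra k (W ⊗[k] V)) :
    regroupMul k V W S L (regroupMul k V W (S ⊗[k] W) (L ⊗[k] V)
      (x ⊗ₜ (((l ⊗ₜ v) ⊗ₜ v') ⊗ₜ p))) =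
    regroupMul k V W S L (regroupMul k V W (S ⊗[k] W) (L ⊗[k] V)
      (TensorProduct.rightComm k S W W x ⊗ₜ (((l ⊗ₜ v') ⊗ₜ v) ⊗ₜ p))) := by
  induction x with
  | zero => simp
  | add x y hx hy => simp only [map_add, TensorProduct.add_tmul, hx, hy]
  | tmul x w' =>
    induction x with
    | zero => simp
    | add x y hx hy => simp only [map_add, TensorProduct.add_tmul, hx, hy]
    | tmul s w => simp [regroupMul_tmul, mul_left_comm]

theorem symExtD_symExtD (n : ℕ) : symExtD k V W n ∘ₗ symExtD k V W (n + 1) = 0 := by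
  suffices h : (regroupMul k V W (SymmetricAlgebra k W) (ExtPow k V n) ∘ₗ
      TensorProduct.map (symCoprod k W)
        ((extCoprod k V n).rTensor (SymmetricAlgebra k (W ⊗[k] V)))) ∘ₗ
      (regroupMul k V W (SymmetricAlgebra k W) (ExtPow k V (n + 1)) ∘ₗ
      TensorProduct.map (symCoprod k W)
        ((extCoprod k V (n + 1)).rTensor (SymmetricAlgebra k (W ⊗[k] V)))) = 0 from h
  refine TensorProduct.ext' fun s y => ?_
  induction y with
  | zero => simp only [TensorProduct.tmul_zero, map_zero]
  | add x y hx hy => rw [TensorProduct.tmul_add, map_add, hx, hy, map_add]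
  | tmul ω p =>
  rw [LinearMap.comp_apply, LinearMap.comp_apply, LinearMap.comp_apply, TensorProduct.map_tmul,
    LinearMap.rTensor_tmul, LinearMap.zero_apply]
  rw [← LinearMap.comp_apply (TensorProduct.map _ _)]
  erw [← regroupMul_map]
  simp only [LinearMap.comp_apply, TensorProduct.map_tmul, LinearMap.rTensor_tmul]
  refine extCoprod_extCoprod n (regroupMul k V W (SymmetricAlgebra k W) (ExtPow k V n) ∘ₗ
    regroupMul k V W (SymmetricAlgebra k W ⊗[k] W) (ExtPow k V n ⊗[k] V) ∘ₗ
    TensorProduct.mk k _ _ ((symCoprod k W).rTensor W (symCoprod k W s)) ∘ₗ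
    (TensorProduct.mk k _ _).flip p) (fun l v v' => ?_) ω
  refine (regroupMul_swap _ _ _ _ _).trans ?_
  rw [symCoprod_symCoprod]
  rfl

/-- The `k`-linear chain complex `(S^*(W) ⊗ Λ^*(V) ⊗ S^*(W ⊗ V), d)`. -/
def symExtComplex (k : Type u) [CommRing k] (V W : Type u) [AddCommGroup V] [Module k V]
    [AddCommGroup W] [Module k W] : ChainComplex (ModuleCat.{u} k) ℕ :=
  ChainComplex.of (fun n => ModuleCat.of k (SymExtTerm k V W n))
    (fun n => ModuleCat.ofHom (symExtD k V W n))
    (fun n => by rw [← ModuleCat.ofHom_comp, symExtD_symExtD]; rfl)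

theorem symExtD_smul (n : ℕ) (s : SymmetricAlgebra k (W ⊗[k] V))
    (x : SymExtTerm k V W (n + 1)) : symExtD k V W n (s • x) = s • symExtD k V W n x := by
  have key : ∀ z : (SymmetricAlgebra k W ⊗[k] W) ⊗[k]
      ((ExtPow k V n ⊗[k] V) ⊗[k] SymmetricAlgebra k (W ⊗[k] V)),
      regroupMul k V W (SymmetricAlgebra k W) (ExtPow k V n)
        (((LinearMap.mulLeft k s).lTensor _).lTensor _ z) =
      ((LinearMap.mulLeft k s).lTensor _).lTensor _ (regroupMul k V W _ _ z) := by
    intro z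
    rw [← LinearMap.comp_apply, ← LinearMap.comp_apply]
    congr 1
    ext
    simp [regroupMul_tmul, mul_left_comm]
  change regroupMul k V W (SymmetricAlgebra k W) (ExtPow k V n)
    (TensorProduct.map (symCoprod k W) ((extCoprod k V n).rTensor _)
      (((LinearMap.mulLeft k s).lTensor _).lTensor _ x)) = 
      ((LinearMap.mulLeft k s).lTensor _).lTensor _ 
      (regroupMul k V W (SymmetricAlgebra k W) (ExtPow k V n)
    (TensorProduct.map (symCoprod k W) ((extCoprod k V n).rTensor _) x))
  rw [← key]
  congr 1
  induction x using TensorProduct.induction_on with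
    | zero => simp
    | add x y hx hy => rw [map_add, map_add, hx, hy, map_add, map_add]
    | tmul a b =>
      simp only [TensorProduct.map_tmul, LinearMap.lTensor_tmul]
      congr 1
      induction b with
      | zero => simp
      | add x y hx hy => rw [map_add, map_add, hx, hy, map_add, map_add]
      | tmul b c => simp

end Target

section Contraction

variable {k : Type u} [CommRing k] {V V' V'' : Type u} [AddCommGroup V] [Module k V]
  [AddCommGroup V'] [Module k V'] [AddCommGroup V''] [Module k V'']

/-- The map `v₀ ∧ ⋯ ∧ vₙ ↦ ∑ i, (-1)^(n-i) φ(vᵢ) p(v₀) ∧ ⋯ (omit i) ⋯ ∧ p(vₙ)`, i.e. the coproduct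
`Λ^{n+1}(V) → Λ^n(V) ⊗ V` followed by `Λ^n(p) ⊗ φ`. -/
def contr (n : ℕ) (φ : V →ₗ[k] k) (p : V →ₗ[k] V') : ExtPow k V (n + 1) →ₗ[k] ExtPow k V' n :=
  (TensorProduct.rid k (ExtPow k V' n)).toLinearMap ∘ₗ
    TensorProduct.map (extMap n p) φ ∘ₗ extCoprod k V n

theorem extMap_comp_contr (n : ℕ) (φ : V →ₗ[k] k) (p : V →ₗ[k] V') (h : V' →ₗ[k] V'') :
    extMap n h ∘ₗ contr n φ p = contr n φ (h ∘ₗ p) := by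
  have : extMap n h ∘ₗ (TensorProduct.rid k (ExtPow k V' n)).toLinearMap ∘ₗ
      TensorProduct.map (extMap n p) φ =
      (TensorProduct.rid k (ExtPow k V'' n)).toLinearMap ∘ₗ
        TensorProduct.map (extMap n (h ∘ₗ p)) φ := by
    refine TensorProduct.ext' fun x y => ?_
    simp [extMap_comp]
  simp only [contr, ← LinearMap.comp_assoc] at this ⊢
  rw [this]

theorem contr_comp_extMap (n : ℕ) (φ : V' →ₗ[k] k) (p : V' →ₗ[k] V'') (g : V →ₗ[k] V') :
    contr n φ p ∘ₗ extMap (n + 1) g = contr n (φ ∘ₗ g) (p ∘ₗ g) := by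
  ext ω
  simp only [contr, LinearMap.comp_apply, extCoprod_map]
  rw [← LinearMap.comp_apply (TensorProduct.map _ _), ← TensorProduct.map_comp, extMap_comp]

/-- Two successive contractions, as a function of the iterated coproduct. -/
theorem contr_contr (n : ℕ) (φ : V →ₗ[k] k) (p : V →ₗ[k] V') (φ' : V' →ₗ[k] k)
    (p' : V' →ₗ[k] V'') (ω : ExtPow k V (n + 2)) :
    contr n φ' p' (contr (n + 1) φ p ω) =
      (TensorProduct.rid k _ (TensorProduct.map ((TensorProduct.rid k _).toLinearMap ∘ₗ
        TensorProduct.map (extMap n (p' ∘ₗ p)) (φ' ∘ₗ p)) φ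
        ((extCoprod k V n).rTensor V (extCoprod k V (n + 1) ω)))) := by
  have h : ∀ z : ExtPow k V (n + 1) ⊗[k] V,
      contr n φ' p' (TensorProduct.rid k _ (TensorProduct.map (extMap (n + 1) p) φ z)) =
      (TensorProduct.rid k _ (TensorProduct.map ((TensorProduct.rid k _).toLinearMap ∘ₗ
        TensorProduct.map (extMap n (p' ∘ₗ p)) (φ' ∘ₗ p)) φ
        ((extCoprod k V n).rTensor V z))) := by
    intro z
    induction z with
    | zero => simp
    | add x y hx hy => simp only [map_add, hx, hy]
    | tmul x v =>
      have := DFunLike.congr_fun (contr_comp_extMap n φ' p' p) x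
      rw [LinearMap.comp_apply] at this
      simp only [TensorProduct.map_tmul, TensorProduct.rid_tmul, map_smul, this,
        LinearMap.rTensor_tmul]
      rfl
  exact h _

theorem contr_contr_antisymm (n : ℕ) {V₁ V₂ : Type u} [AddCommGroup V₁] [Module k V₁]
    [AddCommGroup V₂] [Module k V₂] (φ : V →ₗ[k] k) (p : V →ₗ[k] V₁) (φ' : V₁ →ₗ[k] k)
    (p' : V₁ →ₗ[k] V') (ψ : V →ₗ[k] k) (q : V →ₗ[k] V₂) (ψ' : V₂ →ₗ[k] k)
    (q' : V₂ →ₗ[k] V') (h : p' ∘ₗ p = q' ∘ₗ q) (h₁ : φ' ∘ₗ p = ψ) (h₂ : ψ' ∘ₗ q = φ) :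
    contr n φ' p' ∘ₗ contr (n + 1) φ p = -(contr n ψ' q' ∘ₗ contr (n + 1) ψ q) := by
  ext ω
  rw [LinearMap.neg_apply, LinearMap.comp_apply, LinearMap.comp_apply, contr_contr, contr_contr,
    h, h₁, h₂, eq_neg_iff_add_eq_zero]
  refine extCoprod_extCoprod n ((TensorProduct.rid k _).toLinearMap ∘ₗ
    TensorProduct.map ((TensorProduct.rid k _).toLinearMap ∘ₗ
        TensorProduct.map (extMap n (q' ∘ₗ q)) ψ) φ + (TensorProduct.rid k _).toLinearMap ∘ₗ
    TensorProduct.map ((TensorProduct.rid k _).toLinearMap ∘ₗ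
        TensorProduct.map (extMap n (q' ∘ₗ q)) φ) ψ) (fun x v w => ?_) ω
  simp only [LinearMap.add_apply, LinearMap.comp_apply, TensorProduct.map_tmul,
    LinearEquiv.coe_coe, TensorProduct.rid_tmul, smul_smul, mul_comm (φ _)]
  rw [add_comm]

end Contraction

section Categories

/-- The category of finite sets and injections. -/
structure FI : Type 1 where
  carrier : Type
  [finite : Finite carrier]

instance : CoeSort FI Type := ⟨FI.carrier⟩

attribute [instance] FI.finite

instance : Category FI where
  Hom X Y := X ↪ Y
  id X := Function.Embedding.refl X
  comp f g := Function.Embedding.trans f g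

/-- The category of finite sets and bijections. -/
structure FB : Type 1 where
  carrier : Type
  [finite : Finite carrier]

instance : CoeSort FB Type := ⟨FB.carrier⟩

attribute [instance] FB.finite

instance : Category FB where
  Hom X Y := X ≃ Y
  id X := Equiv.refl X
  comp f g := Equiv.trans f g

/-- The complement of a subset of a finite set. -/
def FI.compl {X : FB} (A : Finset X) : FI := ⟨{x : X // x ∉ A}⟩

/-- The injection between complements of subsets induced by an injection of finite sets. -/
def FI.complMap {X Y : FB} (e : X ↪ Y) (A : Finset X) (B : Finset Y)
    (h : ∀ x, x ∉ A → e x ∉ B) : FI.compl A ⟶ FI.compl B :=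
  (⟨fun x => ⟨e x.1, h x.1 x.2⟩, fun _ _ hxy => Subtype.ext (e.injective (Subtype.ext_iff.1 hxy))⟩ :
    {x : X // x ∉ A} ↪ {y : Y // y ∉ B})

end Categories

section Koszul

open scoped Classical

variable {k : Type u} [CommRing k]

/-- The `n`-element subsets of a finite set. -/
abbrev Sub (n : ℕ) (X : FB) : Type := {A : Finset X // A.card = n}

/-- The value on `X` of the term of homological degree `n` of the Koszul complex of the `FI`-module
`F`: the sum over decompositions `X = A ⨿ (X ∖ A)` with `|A| = n` of `Or(A) ⊗ F(X ∖ A)`, where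
`Or(A) = Λ^{|A|}(k A) = Λ^n(k A)`. -/
abbrev KoszulSpace (n : ℕ) (F : FI ⥤ ModuleCat.{u} k) (X : FB) : Type u :=
  ⨁ A : Sub n X, ExtPow k (A.1 →₀ k) n ⊗[k] F.obj (FI.compl A.1)

/-- The inclusion of the summand of `KoszulSpace` indexed by `A`. -/
abbrev koszulIncl (n : ℕ) (F : FI ⥤ ModuleCat.{u} k) (X : FB) (A : Sub n X) :
    ExtPow k (A.1 →₀ k) n ⊗[k] F.obj (FI.compl A.1) →ₗ[k] KoszulSpace n F X :=
  DirectSum.lof k (Sub n X) (fun A => ExtPow k (A.1 →₀ k) n ⊗[k] F.obj (FI.compl A.1)) A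

/-- The image of a subset under a bijection. -/
def Sub.map {n : ℕ} {X Y : FB} (e : X ≃ Y) (A : Sub n X) : Sub n Y :=
  ⟨A.1.map e.toEmbedding, by simpa using A.2⟩

/-- The bijection `e` gives the linear map `k A → k e(A)`. -/
def freeMap {n : ℕ} {X Y : FB} (e : X ≃ Y) (A : Sub n X) : (A.1 →₀ k) →ₗ[k] ((A.map e).1 →₀ k) :=
  Finsupp.lmapDomain k k fun a => ⟨e a.1, Finset.mem_map_of_mem _ a.2⟩

/-- The bijection `X ∖ A → Y ∖ e(A)` induced by `e`. -/
def Sub.complMap {n : ℕ} {X Y : FB} (e : X ≃ Y) (A : Sub n X) :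
    FI.compl A.1 ⟶ FI.compl (A.map e).1 :=
  FI.complMap e.toEmbedding _ _ fun x hx h => hx (by simpa [Sub.map] using h)

/-- The functoriality of the Koszul complex with respect to bijections: `e : X ≃ Y` maps the
summand `A` to the summand `e(A)` by `Or(e) ⊗ F(e)`. -/
def koszulMap (n : ℕ) (F : FI ⥤ ModuleCat.{u} k) {X Y : FB} (e : X ≃ Y) :
    KoszulSpace n F X →ₗ[k] KoszulSpace n F Y :=
  DirectSum.toModule k _ _ fun A => koszulIncl n F Y (A.map e) ∘ₗ
    TensorProduct.map (extMap n (freeMap e A)) (F.map (A.complMap e)).hom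

/-- The functoriality of the Koszul complex with respect to the `FI`-module. -/
def koszulNat (n : ℕ) {F G : FI ⥤ ModuleCat.{u} k} (η : F ⟶ G) (X : FB) :
    KoszulSpace n F X →ₗ[k] KoszulSpace n G X :=
  DirectSum.toModule k _ _ fun A => koszulIncl n G X A ∘ₗ
    TensorProduct.map LinearMap.id (η.app _).hom

/-- Removing an element from a subset. -/
def Sub.erase {n : ℕ} {X : FB} (A : Sub (n + 1) X) (x : A.1) : Sub n X :=
  ⟨A.1.erase x.1, by rw [Finset.card_erase_of_mem x.2, A.2]; rfl⟩

/-- The linear map `k A → k (A ∖ {x})` which kills `x` and fixes the other basis elements. -/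
def freeRes {n : ℕ} {X : FB} (A : Sub (n + 1) X) (x : A.1) :
    (A.1 →₀ k) →ₗ[k] ((A.erase x).1 →₀ k) :=
  Finsupp.lcomapDomain (fun a => ⟨a.1, Finset.mem_of_mem_erase a.2⟩)
    fun _ _ h => Subtype.ext (congrArg (fun z : A.1 => z.1) h)

/-- The inclusion `X ∖ A → X ∖ (A ∖ {x})`, a morphism of `FI`. -/
def Sub.complErase {n : ℕ} {X : FB} (A : Sub (n + 1) X) (x : A.1) :
    FI.compl A.1 ⟶ FI.compl (A.erase x).1 :=
  FI.complMap (Function.Embedding.refl _) _ _ fun _ hy h => hy (Finset.mem_of_mem_erase h)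

/-- The Koszul differential: the summand `Or(A) ⊗ F(X ∖ A)` is mapped to the sum over `x ∈ A` of
the summands `Or(A ∖ {x}) ⊗ F((X ∖ A) ∪ {x})`, by sending `x₀ ∧ ⋯ ∧ xₙ` to
`(-1)^(n-i) x₀ ∧ ⋯ (omit xᵢ) ⋯ ∧ xₙ` for `x = xᵢ`, and by applying `F` to the inclusion. -/
def koszulD (n : ℕ) (F : FI ⥤ ModuleCat.{u} k) (X : FB) :
    KoszulSpace (n + 1) F X →ₗ[k] KoszulSpace n F X :=
  DirectSum.toModule k _ _ fun A => ∑ x : A.1, koszulIncl n F X (A.erase x) ∘ₗ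
    TensorProduct.map (contr n (Finsupp.lapply x) (freeRes A x)) (F.map (A.complErase x)).hom

theorem koszulMap_incl (n : ℕ) (F : FI ⥤ ModuleCat.{u} k) {X Y : FB} (e : X ≃ Y) (A : Sub n X) :
    koszulMap n F e ∘ₗ koszulIncl n F X A = koszulIncl n F Y (A.map e) ∘ₗ
      TensorProduct.map (extMap n (freeMap e A)) (F.map (A.complMap e)).hom := by
  ext; simp [koszulMap]

theorem koszulNat_incl (n : ℕ) {F G : FI ⥤ ModuleCat.{u} k} (η : F ⟶ G) (X : FB) (A : Sub n X) :
    koszulNat n η X ∘ₗ koszulIncl n F X A = koszulIncl n G X A ∘ₗ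
      TensorProduct.map LinearMap.id (η.app _).hom := by
  ext; simp [koszulNat]

theorem koszulD_incl (n : ℕ) (F : FI ⥤ ModuleCat.{u} k) (X : FB) (A : Sub (n + 1) X) :
    koszulD n F X ∘ₗ koszulIncl (n + 1) F X A = ∑ x : A.1, koszulIncl n F X (A.erase x) ∘ₗ
      TensorProduct.map (contr n (Finsupp.lapply x) (freeRes A x))
        (F.map (A.complErase x)).hom := by
  ext; simp [koszulD]

/-- The linear map `k A → k X` for a subset `A` of `X`. -/
def freeIncl {n : ℕ} {X : FB} (A : Sub n X) : (A.1 →₀ k) →ₗ[k] (X →₀ k) :=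
  Finsupp.lmapDomain k k Subtype.val

theorem extMap_freeIncl_injective {n : ℕ} {X : FB} (A : Sub n X) :
    Function.Injective (extMap n (freeIncl (k := k) A)) := by
  refine exteriorPower.map_injective
    (Finsupp.lcomapDomain Subtype.val Subtype.val_injective) ?_
  ext a : 2
  simp [freeIncl, Finsupp.lcomapDomain]

theorem koszulIncl_congr {n : ℕ} (F : FI ⥤ ModuleCat.{u} k) {X : FB} {A B : Sub n X} (h : A = B)
    {T : Type u} [AddCommGroup T] [Module k T] {Z : FI}
    (g : T →ₗ[k] ExtPow k (A.1 →₀ k) n) (g' : T →ₗ[k] ExtPow k (B.1 →₀ k) n)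
    (hg : extMap n (freeIncl A) ∘ₗ g = extMap n (freeIncl B) ∘ₗ g')
    (v : Z ⟶ FI.compl A.1) (v' : Z ⟶ FI.compl B.1)
    (hv : ∀ z, (v.toFun z).1 = (v'.toFun z).1) :
    koszulIncl n F X A ∘ₗ TensorProduct.map g (F.map v).hom =
      koszulIncl n F X B ∘ₗ TensorProduct.map g' (F.map v').hom := by
  subst h
  have h₁ : g = g' := LinearMap.ext fun t =>
    extMap_freeIncl_injective A (DFunLike.congr_fun hg t)
  have h₂ : v = v' := Function.Embedding.ext fun z => Subtype.ext (hv z)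
  rw [h₁, h₂]

theorem sum_comp' {ι M N P : Type*} [Fintype ι] [AddCommGroup M] [AddCommGroup N]
    [AddCommGroup P] [Module k M] [Module k N] [Module k P] (f : ι → N →ₗ[k] P) (g : M →ₗ[k] N) :
    (∑ i, f i) ∘ₗ g = ∑ i, f i ∘ₗ g := by
  ext; simp

theorem comp_sum' {ι M N P : Type*} [Fintype ι] [AddCommGroup M] [AddCommGroup N]
    [AddCommGroup P] [Module k M] [Module k N] [Module k P] (f : ι → M →ₗ[k] N) (g : N →ₗ[k] P) :
    g ∘ₗ (∑ i, f i) = ∑ i, g ∘ₗ f i := by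
  ext; simp

theorem Sub.map_refl {n : ℕ} {X : FB} (A : Sub n X) : A.map (Equiv.refl X) = A :=
  Subtype.ext (by simp [Sub.map])

theorem Sub.map_trans {n : ℕ} {X Y Z : FB} (e : X ≃ Y) (f : Y ≃ Z) (A : Sub n X) :
    A.map (e.trans f) = (A.map e).map f :=
  Subtype.ext (by simp [Sub.map, Finset.map_map])

theorem freeIncl_freeMap {n : ℕ} {X Y : FB} (e : X ≃ Y) (A : Sub n X) :
    freeIncl (A.map e) ∘ₗ freeMap (k := k) e A = Finsupp.lmapDomain k k e ∘ₗ freeIncl A := by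
  ext a : 2
  simp [freeIncl, freeMap]

theorem freeRes_self {n : ℕ} {X : FB} (A : Sub (n + 1) X) (x a : A.1) (h : a.1 = x.1) :
    freeRes A x (Finsupp.single a (1 : k)) = 0 := by
  ext b
  refine Finsupp.single_eq_of_ne fun h' => ?_
  exact Finset.ne_of_mem_erase b.2 ((congrArg (fun z : A.1 => z.1) h').trans h)

theorem freeRes_of_ne {n : ℕ} {X : FB} (A : Sub (n + 1) X) (x a : A.1) (h : a.1 ≠ x.1) :
    freeRes A x (Finsupp.single a (1 : k)) =
      Finsupp.single ⟨a.1, Finset.mem_erase.2 ⟨h, a.2⟩⟩ 1 := by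
  ext b
  simp [freeRes, Finsupp.lcomapDomain, Finsupp.single_apply, Subtype.ext_iff]

theorem freeIncl_single {n : ℕ} {X : FB} (A : Sub n X) (a : A.1) :
    freeIncl A (Finsupp.single a (1 : k)) = Finsupp.single a.1 1 := by
  simp [freeIncl]

theorem freeMap_single {n : ℕ} {X Y : FB} (e : X ≃ Y) (A : Sub n X) (a : A.1) :
    freeMap e A (Finsupp.single a (1 : k)) =
      Finsupp.single ⟨e a.1, Finset.mem_map_of_mem _ a.2⟩ 1 := by
  simp [freeMap]

theorem freeIncl_freeRes_single {n : ℕ} {X : FB} (A : Sub (n + 1) X) (x a : A.1) :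
    freeIncl (A.erase x) (freeRes A x (Finsupp.single a (1 : k))) =
      if a.1 = x.1 then 0 else Finsupp.single a.1 1 := by
  split_ifs with h
  · rw [freeRes_self _ _ _ h, map_zero]
  · rw [freeRes_of_ne _ _ _ h, freeIncl_single]

theorem lapply_freeRes {n : ℕ} {X : FB} (A : Sub (n + 1) X) (x : A.1) (y : (A.erase x).1) :
    Finsupp.lapply (R := k) y ∘ₗ freeRes (k := k) A x =
      Finsupp.lapply ⟨y.1, Finset.mem_of_mem_erase y.2⟩ := rfl

theorem koszulMap_refl (n : ℕ) (F : FI ⥤ ModuleCat.{u} k) (X : FB) :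
    koszulMap n F (Equiv.refl X) = LinearMap.id := by
  refine DirectSum.linearMap_ext _ fun A => ?_
  refine (koszulMap_incl n F _ A).trans ?_
  rw [koszulIncl_congr F A.map_refl _ LinearMap.id _ _ (𝟙 _) (fun _ => rfl)]
  · simp
  · rw [← extMap_comp, freeIncl_freeMap]
    rw [LinearMap.comp_id]
    congr 1
    ext a : 2
    simp

theorem koszulMap_trans (n : ℕ) (F : FI ⥤ ModuleCat.{u} k) {X Y Z : FB} (e : X ≃ Y) (f : Y ≃ Z) :
    koszulMap n F (e.trans f) = koszulMap n F f ∘ₗ koszulMap n F e := by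
  refine DirectSum.linearMap_ext _ fun A => ?_
  refine (koszulMap_incl n F _ A).trans ?_
  change _ = koszulMap n F f ∘ₗ (koszulMap n F e ∘ₗ koszulIncl n F X A)
  rw [koszulMap_incl, ← LinearMap.comp_assoc, koszulMap_incl, LinearMap.comp_assoc,
    ← TensorProduct.map_comp, ← ModuleCat.hom_comp, ← F.map_comp]
  refine koszulIncl_congr F (A.map_trans e f) _ _ ?_ _ _ (fun _ => rfl)
  rw [← extMap_comp, ← LinearMap.comp_assoc, ← extMap_comp, ← extMap_comp]
  simp only [freeIncl_freeMap]
  rw [LinearMap.comp_assoc, freeIncl_freeMap]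
  congr 1
  ext a : 2
  simp [freeIncl]

theorem koszulNat_id (n : ℕ) (F : FI ⥤ ModuleCat.{u} k) (X : FB) :
    koszulNat n (𝟙 F) X = LinearMap.id := by
  refine DirectSum.linearMap_ext _ fun A => ?_
  refine (koszulNat_incl n _ X A).trans ?_
  simp

theorem koszulNat_comp (n : ℕ) {F G H : FI ⥤ ModuleCat.{u} k} (η : F ⟶ G) (θ : G ⟶ H) (X : FB) :
    koszulNat n (η ≫ θ) X = koszulNat n θ X ∘ₗ koszulNat n η X := by
  refine DirectSum.linearMap_ext _ fun A => ?_
  refine (koszulNat_incl n _ X A).trans ?_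
  change _ = koszulNat n θ X ∘ₗ (koszulNat n η X ∘ₗ koszulIncl n F X A)
  rw [koszulNat_incl, ← LinearMap.comp_assoc, koszulNat_incl, LinearMap.comp_assoc,
    ← TensorProduct.map_comp]
  rfl

theorem koszulNat_koszulMap (n : ℕ) {F G : FI ⥤ ModuleCat.{u} k} (η : F ⟶ G) {X Y : FB}
    (e : X ≃ Y) : koszulNat n η Y ∘ₗ koszulMap n F e = koszulMap n G e ∘ₗ koszulNat n η X := by
  refine DirectSum.linearMap_ext _ fun A => ?_
  change koszulNat n η Y ∘ₗ (koszulMap n F e ∘ₗ koszulIncl n F X A) =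
    koszulMap n G e ∘ₗ (koszulNat n η X ∘ₗ koszulIncl n F X A)
  rw [koszulNat_incl, koszulMap_incl, ← LinearMap.comp_assoc, ← LinearMap.comp_assoc,
    koszulNat_incl, koszulMap_incl, LinearMap.comp_assoc, LinearMap.comp_assoc,
    ← TensorProduct.map_comp, ← TensorProduct.map_comp, ← ModuleCat.hom_comp,
    ← ModuleCat.hom_comp, η.naturality]
  rfl

theorem koszulD_koszulNat (n : ℕ) {F G : FI ⥤ ModuleCat.{u} k} (η : F ⟶ G) (X : FB) :
    koszulD n G X ∘ₗ koszulNat (n + 1) η X = koszulNat n η X ∘ₗ koszulD n F X := by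
  refine DirectSum.linearMap_ext _ fun A => ?_
  change koszulD n G X ∘ₗ (koszulNat (n + 1) η X ∘ₗ koszulIncl (n + 1) F X A) =
    koszulNat n η X ∘ₗ (koszulD n F X ∘ₗ koszulIncl (n + 1) F X A)
  rw [koszulNat_incl, koszulD_incl, ← LinearMap.comp_assoc, koszulD_incl,
    sum_comp', comp_sum']
  refine Finset.sum_congr rfl fun x _ => ?_
  rw [← LinearMap.comp_assoc _ _ (koszulNat n η X), koszulNat_incl, LinearMap.comp_assoc,
    LinearMap.comp_assoc,
    ← TensorProduct.map_comp, ← TensorProduct.map_comp, ← ModuleCat.hom_comp,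
    ← ModuleCat.hom_comp, η.naturality]
  rfl

theorem koszulD_koszulMap (n : ℕ) (F : FI ⥤ ModuleCat.{u} k) {X Y : FB} (e : X ≃ Y) :
    koszulD n F Y ∘ₗ koszulMap (n + 1) F e = koszulMap n F e ∘ₗ koszulD n F X := by
  refine DirectSum.linearMap_ext _ fun A => ?_
  change koszulD n F Y ∘ₗ (koszulMap (n + 1) F e ∘ₗ koszulIncl (n + 1) F X A) =
    koszulMap n F e ∘ₗ (koszulD n F X ∘ₗ koszulIncl (n + 1) F X A)
  rw [koszulMap_incl, koszulD_incl, ← LinearMap.comp_assoc, koszulD_incl,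
    sum_comp', comp_sum']
  let E : A.1 ≃ (A.map e).1 := e.subtypeEquiv fun a => by simp [Sub.map]
  refine (Fintype.sum_equiv E _ _ fun x => ?_).symm
  rw [← LinearMap.comp_assoc, koszulMap_incl, LinearMap.comp_assoc, LinearMap.comp_assoc,
    ← TensorProduct.map_comp, ← TensorProduct.map_comp, ← ModuleCat.hom_comp,
    ← ModuleCat.hom_comp, ← F.map_comp, ← F.map_comp]
  refine koszulIncl_congr F (Subtype.ext (by simp [Sub.map, Sub.erase]; rfl)) _ _ ?_ _ _
    (fun _ => rfl)
  rw [extMap_comp_contr, contr_comp_extMap, extMap_comp_contr, extMap_comp_contr]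
  congr 1
  · ext a : 2
    simp only [LinearMap.comp_apply, Finsupp.lsingle_apply, freeMap_single, Finsupp.lapply_apply,
      Finsupp.single_apply]
    exact if_congr (E.injective.eq_iff (a := a) (b := x)).symm rfl rfl
  · ext a : 2
    have h1 := DFunLike.congr_fun (freeIncl_freeMap (k := k) e (A.erase x))
      (freeRes A x (Finsupp.single a 1))
    simp only [LinearMap.comp_apply] at h1
    simp only [LinearMap.comp_apply, Finsupp.lsingle_apply]
    rw [h1, freeIncl_freeRes_single, freeMap_single, freeIncl_freeRes_single]
    simp only [E, Equiv.subtypeEquiv_apply, EmbeddingLike.apply_eq_iff_eq]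
    split_ifs <;> simp

theorem koszulD_koszulD (n : ℕ) (F : FI ⥤ ModuleCat.{u} k) (X : FB) :
    koszulD n F X ∘ₗ koszulD (n + 1) F X = 0 := by
  refine DirectSum.linearMap_ext _ fun A => ?_
  change koszulD n F X ∘ₗ (koszulD (n + 1) F X ∘ₗ koszulIncl (n + 2) F X A) = 0
  rw [koszulD_incl, comp_sum']
  simp only [← LinearMap.comp_assoc, koszulD_incl, sum_comp']
  rw [Finset.sum_sigma']
  refine Finset.sum_involution (fun p _ => ⟨⟨p.2.1, Finset.mem_of_mem_erase p.2.2⟩,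
    ⟨p.1.1, Finset.mem_erase.2 ⟨fun h => Finset.ne_of_mem_erase p.2.2 h.symm, p.1.2⟩⟩⟩)
    ?_ ?_ ?_ ?_
  · rintro ⟨x, y⟩ _
    simp only [LinearMap.comp_assoc, ← TensorProduct.map_comp, ← ModuleCat.hom_comp,
      ← F.map_comp]
    have hx : x.1 ∈ A.1.erase y.1 :=
      Finset.mem_erase.2 ⟨fun h => Finset.ne_of_mem_erase y.2 h.symm, x.2⟩
    have hy : y.1 ∈ A.1 := Finset.mem_of_mem_erase y.2
    have key : koszulIncl n F X ((A.erase x).erase y) ∘ₗ TensorProduct.map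
          (contr n (Finsupp.lapply y) (freeRes (A.erase x) y) ∘ₗ
            contr (n + 1) (Finsupp.lapply x) (freeRes A x))
          (F.map (A.complErase x ≫ (A.erase x).complErase y)).hom =
        koszulIncl n F X ((A.erase ⟨y.1, hy⟩).erase ⟨x.1, hx⟩) ∘ₗ TensorProduct.map
          (-(contr n (Finsupp.lapply ⟨x.1, hx⟩) (freeRes (A.erase ⟨y.1, hy⟩) ⟨x.1, hx⟩) ∘ₗ
            contr (n + 1) (Finsupp.lapply ⟨y.1, hy⟩) (freeRes A ⟨y.1, hy⟩)))
          (F.map (A.complErase ⟨y.1, hy⟩ ≫ (A.erase ⟨y.1, hy⟩).complErase ⟨x.1, hx⟩)).hom := by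
      refine koszulIncl_congr F (Subtype.ext (Finset.erase_right_comm)) _ _ ?_ _ _ (fun _ => rfl)
      rw [LinearMap.comp_neg, ← LinearMap.comp_assoc, ← LinearMap.comp_assoc, extMap_comp_contr,
        extMap_comp_contr]
      refine contr_contr_antisymm n _ _ _ _ _ _ _ _ ?_ ?_ ?_
      · ext a : 2
        simp only [LinearMap.comp_apply, Finsupp.lsingle_apply]
        by_cases h₁ : a.1 = x.1
        · rw [freeRes_self _ _ _ h₁, freeRes_of_ne A ⟨y.1, hy⟩ a (fun h =>
            Finset.ne_of_mem_erase y.2 (h.symm.trans h₁)), freeIncl_freeRes_single, if_pos h₁]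
          simp
        · by_cases h₂ : a.1 = y.1
          · rw [freeRes_of_ne _ _ _ h₁, freeIncl_freeRes_single, if_pos h₂,
              freeRes_self _ _ _ h₂]
            simp
          · rw [freeRes_of_ne _ _ _ h₁, freeIncl_freeRes_single, if_neg h₂,
              freeRes_of_ne _ _ _ h₂, freeIncl_freeRes_single, if_neg h₁]
      · rfl
      · rfl
    refine (congrArg₂ (· + ·) key rfl).trans ?_
    refine TensorProduct.ext' fun t s => ?_
    simp only [LinearMap.add_apply, LinearMap.comp_apply, TensorProduct.map_tmul,
      LinearMap.neg_apply, TensorProduct.neg_tmul, map_neg, LinearMap.zero_apply]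
    exact neg_add_cancel _
  · rintro ⟨x, y⟩ _ _ h
    have := congrArg (fun p => p.1.1) h
    exact Finset.ne_of_mem_erase y.2 this
  · intros; simp
  · rintro ⟨x, y⟩ _; rfl

variable (k) in
/-- The functor `F ↦ Kz_n F = (Or ⊙ F)` in homological degree `n`, from `FI`-modules to
representations of the groupoid of finite sets and bijections. -/
def koszulTerm (n : ℕ) : (FI ⥤ ModuleCat.{u} k) ⥤ FB ⥤ ModuleCat.{u} k where
  obj F :=
    { obj := fun X => ModuleCat.of k (KoszulSpace n F X)
      map := fun e => ModuleCat.ofHom (koszulMap n F e)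
      map_id := fun X => by
        rw [← ModuleCat.ofHom_id, ← koszulMap_refl]
      map_comp := fun e f => by
        rw [← ModuleCat.ofHom_comp, ← koszulMap_trans] }
  map η :=
    { app := fun X => ModuleCat.ofHom (koszulNat n η X)
      naturality := fun X Y e => by
        rw [← ModuleCat.ofHom_comp, ← ModuleCat.ofHom_comp, koszulNat_koszulMap] }
  map_id F := by
    ext X : 2
    exact congrArg ModuleCat.ofHom (koszulNat_id n F X)
  map_comp η θ := by
    ext X : 2
    exact congrArg ModuleCat.ofHom (koszulNat_comp n η θ X)

variable (k) in
/-- The Koszul differential `Kz_{n+1} F → Kz_n F`, natural in `F`. -/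
def koszulDiff (n : ℕ) : koszulTerm k (n + 1) ⟶ koszulTerm k n where
  app F :=
    { app := fun X => ModuleCat.ofHom (koszulD n F X)
      naturality := fun X Y e => congrArg ModuleCat.ofHom (koszulD_koszulMap n F e) }
  naturality F G η := by
    ext X : 2
    exact congrArg ModuleCat.ofHom (koszulD_koszulNat n η X)

theorem koszulDiff_koszulDiff (n : ℕ) : koszulDiff k (n + 1) ≫ koszulDiff k n = 0 := by
  ext F X : 4
  exact congrArg ModuleCat.ofHom (koszulD_koszulD n F X)

end Koszul

section HomTr

open scoped Classical

variable (k : Type u) [CommRing k]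

/-- The map `k hom(X, B) → k hom(Y, B)` induced by `i : X ↪ Y`, sending `[f]` to the sum of the
`[f']` over all injections `f'` with `f' ∘ i = f`. -/
def trMap (B : FB) {X Y : FI} (i : X ↪ Y) : ((X ↪ B) →₀ k) →ₗ[k] ((Y ↪ B) →₀ k) :=
  Finsupp.linearCombination k fun f =>
    ∑ f' ∈ (Set.toFinite {f' : Y ↪ B | i.trans f' = f}).toFinset, Finsupp.single f' 1

/-- The postcomposition with a bijection `k hom(X, B) → k hom(X, B')`. -/
def postMap {B B' : FB} (σ : B ≃ B') (X : FI) : ((X ↪ B) →₀ k) →ₗ[k] ((X ↪ B') →₀ k) :=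
  Finsupp.lmapDomain k k fun f => f.trans σ.toEmbedding

variable {k}

theorem trMap_apply (B : FB) {X Y : FI} (i : X ↪ Y) (φ : (X ↪ B) →₀ k) (g : Y ↪ B) :
    trMap k B i φ g = φ (i.trans g) := by
  induction φ using Finsupp.induction_linear with
  | zero => simp
  | add x y hx hy => simp [hx, hy]
  | single f c =>
    simp only [trMap, Finsupp.linearCombination_single, Finsupp.smul_apply, Finsupp.finsetSum_apply,
      Finsupp.single_apply, Finset.sum_ite_eq', Set.Finite.mem_toFinset, Set.mem_ofPred_eq]
    by_cases h : f = i.trans g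
    · simp [h]
    · simp [h, Ne.symm h]

theorem postMap_apply {B B' : FB} (σ : B ≃ B') (X : FI) (φ : (X ↪ B) →₀ k) (g : X ↪ B') :
    postMap k σ X φ g = φ (g.trans σ.symm.toEmbedding) := by
  have hg : g = (g.trans σ.symm.toEmbedding).trans σ.toEmbedding := by ext; simp
  conv_lhs => rw [hg]
  refine Finsupp.mapDomain_apply (fun f f' h => ?_) _ _
  ext x
  exact σ.injective (DFunLike.congr_fun h x)

variable (k) in
/-- The bifunctor `k hom_FI(-, -)^tr`; the first variable of this functor is the target `B`,
functorial for bijections, and the second one is the source, covariant on `FI`. -/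
def homTr : FB ⥤ FI ⥤ ModuleCat.{u} k where
  obj B :=
    { obj := fun X => ModuleCat.of k ((X ↪ B) →₀ k)
      map := fun i => ModuleCat.ofHom (trMap k B i)
      map_id := fun X => by
        refine ModuleCat.hom_ext (LinearMap.ext fun φ => Finsupp.ext fun g => ?_)
        exact trMap_apply B _ φ g
      map_comp := fun i j => by
        rw [← ModuleCat.ofHom_comp]
        congr 1
        refine LinearMap.ext fun φ => Finsupp.ext fun g => ?_
        rw [LinearMap.comp_apply, trMap_apply, trMap_apply, trMap_apply]
        rfl }
  map σ :=
    { app := fun X => ModuleCat.ofHom (postMap k σ X)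
      naturality := fun X Y i => by
        rw [← ModuleCat.ofHom_comp, ← ModuleCat.ofHom_comp]
        congr 1
        refine LinearMap.ext fun φ => Finsupp.ext fun g => ?_
        rw [LinearMap.comp_apply, LinearMap.comp_apply, trMap_apply, postMap_apply, postMap_apply,
          trMap_apply]
        rfl }
  map_id B := by
    ext X : 2
    refine ModuleCat.hom_ext (LinearMap.ext fun φ => Finsupp.ext fun g => ?_)
    exact postMap_apply _ X φ g
  map_comp σ τ := by
    ext X : 2
    refine ModuleCat.hom_ext (LinearMap.ext fun φ => Finsupp.ext fun g => ?_)
    refine (postMap_apply _ X φ g).trans ?_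
    exact ((postMap_apply τ X (postMap k σ X φ) g).trans (postMap_apply σ X φ _)).symm

variable (k) in
/-- The Koszul complex `Kz_• k hom_FI(-, -)`; its value on `(B, X)` is `Kz_• F (X)` for the
`FI`-module `F = k hom_FI(-, B)^tr`. -/
def koszulHom : ChainComplex (FB ⥤ FB ⥤ ModuleCat.{u} k) ℕ :=
  ChainComplex.of (fun n => homTr k ⋙ koszulTerm k n)
    (fun n => Functor.whiskerLeft (homTr k) (koszulDiff k n))
    (fun n => by
      rw [← Functor.whiskerLeft_comp, koszulDiff_koszulDiff]; rfl)

end HomTr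

section Schur

variable {k : Type u} [CommRing k]

/-- The standard finite set with `n` elements. -/
def FB.fin (n : ℕ) : FB := ⟨Fin n⟩

/-- The tensor power `V^{⊗n}`. -/
abbrev TPow (k : Type u) [CommRing k] (V : Type u) [AddCommGroup V] [Module k V] (n : ℕ) :
    Type u :=
  PiTensorProduct k fun _ : Fin n => V

/-- The action of a permutation on `V^{⊗n}` by place permutation. -/
def placePerm {V : Type u} [AddCommGroup V] [Module k V] {n : ℕ} (σ : Equiv.Perm (Fin n)) :
    TPow k V n →ₗ[k] TPow k V n :=
  (PiTensorProduct.reindex k (fun _ => V) σ).toLinearMap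

/-- The action of `S_b × S_a` on `M(b, a)`. -/
def bimodAct (M : FB ⥤ FB ⥤ ModuleCat.{u} k) (a b : ℕ)
    (g : Equiv.Perm (Fin b) × Equiv.Perm (Fin a)) :
    (M.obj (FB.fin b)).obj (FB.fin a) →ₗ[k] (M.obj (FB.fin b)).obj (FB.fin a) :=
  ((M.map (show FB.fin b ⟶ FB.fin b from g.1)).app (FB.fin a)).hom ∘ₗ
    ((M.obj (FB.fin b)).map (show FB.fin a ⟶ FB.fin a from g.2)).hom

theorem placePerm_tprod {V : Type u} [AddCommGroup V] [Module k V] {n : ℕ}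
    (σ : Equiv.Perm (Fin n)) (v : Fin n → V) :
    placePerm (k := k) σ (PiTensorProduct.tprod k v) =
      PiTensorProduct.tprod k fun i => v (σ.symm i) :=
  PiTensorProduct.reindex_tprod (s := fun _ => V) σ v

theorem placePerm_one {V : Type u} [AddCommGroup V] [Module k V] {n : ℕ} :
    placePerm (k := k) (V := V) (1 : Equiv.Perm (Fin n)) = LinearMap.id := by
  refine PiTensorProduct.ext (MultilinearMap.ext fun v => ?_)
  exact placePerm_tprod 1 v

theorem placePerm_mul {V : Type u} [AddCommGroup V] [Module k V] {n : ℕ}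
    (σ τ : Equiv.Perm (Fin n)) :
    placePerm (k := k) (V := V) (σ * τ) = placePerm σ ∘ₗ placePerm τ := by
  refine PiTensorProduct.ext (MultilinearMap.ext fun v => ?_)
  simp only [LinearMap.compMultilinearMap_apply, LinearMap.comp_apply, placePerm_tprod]
  rfl

theorem bimodAct_one (M : FB ⥤ FB ⥤ ModuleCat.{u} k) (a b : ℕ) :
    bimodAct M a b 1 = LinearMap.id := by
  have h₁ : M.map (show FB.fin b ⟶ FB.fin b from (1 : Equiv.Perm (Fin b))) = 𝟙 _ := M.map_id _
  have h₂ : (M.obj (FB.fin b)).map (show FB.fin a ⟶ FB.fin a from (1 : Equiv.Perm (Fin a))) =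
    𝟙 _ := (M.obj (FB.fin b)).map_id _
  rw [bimodAct, Prod.fst_one, Prod.snd_one, h₁, h₂]
  rfl

theorem bimodAct_mul (M : FB ⥤ FB ⥤ ModuleCat.{u} k) (a b : ℕ)
    (g h : Equiv.Perm (Fin b) × Equiv.Perm (Fin a)) :
    bimodAct M a b (g * h) = bimodAct M a b g ∘ₗ bimodAct M a b h := by
  have h₁ : M.map (show FB.fin b ⟶ FB.fin b from g.1 * h.1) =
    M.map (show FB.fin b ⟶ FB.fin b from h.1) ≫ M.map (show FB.fin b ⟶ FB.fin b from g.1) :=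
      M.map_comp (X := FB.fin b) (Y := FB.fin b) (Z := FB.fin b) h.1 g.1
  have h₂ : (M.obj (FB.fin b)).map (show FB.fin a ⟶ FB.fin a from g.2 * h.2) =
    (M.obj (FB.fin b)).map (show FB.fin a ⟶ FB.fin a from h.2) ≫
      (M.obj (FB.fin b)).map (show FB.fin a ⟶ FB.fin a from g.2) :=
      (M.obj (FB.fin b)).map_comp (X := FB.fin a) (Y := FB.fin a) (Z := FB.fin a) h.2 g.2
  have h₃ := (M.map (show FB.fin b ⟶ FB.fin b from h.1)).naturality
    (show FB.fin a ⟶ FB.fin a from g.2)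
  simp only [bimodAct, Prod.fst_mul, Prod.snd_mul, ← ModuleCat.hom_comp]
  rw [h₁, h₂, NatTrans.comp_app]
  simp only [Category.assoc]
  rw [reassoc_of% h₃]

variable (V W : Type u) [AddCommGroup V] [Module k V] [AddCommGroup W] [Module k W]

/-- The diagonal action of `S_b × S_a` on `W^{⊗b} ⊗ M(b, a) ⊗ V^{⊗a}`. -/
def schurRep (M : FB ⥤ FB ⥤ ModuleCat.{u} k) (a b : ℕ) :
    Representation k (Equiv.Perm (Fin b) × Equiv.Perm (Fin a))
      (TPow k W b ⊗[k] ((M.obj (FB.fin b)).obj (FB.fin a) ⊗[k] TPow k V a)) where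
  toFun g := TensorProduct.map (placePerm g.1) (TensorProduct.map (bimodAct M a b g)
    (placePerm g.2))
  map_one' := by
    rw [Prod.fst_one, Prod.snd_one, placePerm_one, placePerm_one, bimodAct_one,
      TensorProduct.map_id, TensorProduct.map_id]
    rfl
  map_mul' g h := by
    rw [Prod.fst_mul, Prod.snd_mul, placePerm_mul, placePerm_mul, bimodAct_mul,
      TensorProduct.map_comp, TensorProduct.map_comp]
    rfl

/-- The polynomial bidegree `(a, b)` part `W^{⊗b} ⊗_{S_b} M(b, a) ⊗_{S_a} V^{⊗a}` of the Schur
bifunctor of `M`. -/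
abbrev SchurPart (M : FB ⥤ FB ⥤ ModuleCat.{u} k) (p : ℕ × ℕ) : Type u :=
  (schurRep V W M p.1 p.2).Coinvariants

variable {V W} in
/-- The map on the bidegree `(a, b)` part of Schur bifunctors induced by linear maps `f`, `g` and a
natural transformation `η`. -/
def schurPartMap {V' W' : Type u} [AddCommGroup V'] [Module k V'] [AddCommGroup W'] [Module k W']
    (f : V →ₗ[k] V') (g : W →ₗ[k] W') {M N : FB ⥤ FB ⥤ ModuleCat.{u} k} (η : M ⟶ N)
    (p : ℕ × ℕ) : SchurPart V W M p →ₗ[k] SchurPart V' W' N p :=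
  Representation.Coinvariants.map _ _
    ⟨TensorProduct.map (PiTensorProduct.map fun _ => g)
      (TensorProduct.map ((η.app (FB.fin p.2)).app (FB.fin p.1)).hom
        (PiTensorProduct.map fun _ => f)), fun σ => by
    have hW : (PiTensorProduct.map fun _ => g) ∘ₗ placePerm (k := k) σ.1 =
        placePerm σ.1 ∘ₗ (PiTensorProduct.map fun _ => g) :=
      PiTensorProduct.ext (MultilinearMap.ext fun v => by
        simp [placePerm_tprod, PiTensorProduct.map_tprod])
    have hV : (PiTensorProduct.map fun _ => f) ∘ₗ placePerm (k := k) σ.2 =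
        placePerm σ.2 ∘ₗ (PiTensorProduct.map fun _ => f) :=
      PiTensorProduct.ext (MultilinearMap.ext fun v => by
        simp [placePerm_tprod, PiTensorProduct.map_tprod])
    have hM : ((η.app (FB.fin p.2)).app (FB.fin p.1)).hom ∘ₗ bimodAct M p.1 p.2 σ =
        bimodAct N p.1 p.2 σ ∘ₗ ((η.app (FB.fin p.2)).app (FB.fin p.1)).hom := by
      have h₁ := congrArg (fun θ => NatTrans.app θ (FB.fin p.1))
        (η.naturality (show FB.fin p.2 ⟶ FB.fin p.2 from σ.1))
      have h₂ := (η.app (FB.fin p.2)).naturality (show FB.fin p.1 ⟶ FB.fin p.1 from σ.2)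
      simp only [NatTrans.comp_app] at h₁
      simp only [bimodAct, ← ModuleCat.hom_comp, Category.assoc, h₁]
      rw [reassoc_of% h₂]
    change TensorProduct.map _ _ ∘ₗ TensorProduct.map _ _ =
      TensorProduct.map _ _ ∘ₗ TensorProduct.map _ _
    rw [← TensorProduct.map_comp, ← TensorProduct.map_comp, ← TensorProduct.map_comp,
      ← TensorProduct.map_comp, hW, hV, hM]⟩

variable {V W} in
/-- The functoriality of the Schur bifunctor with respect to all of its data. -/
def schurMap {V' W' : Type u} [AddCommGroup V'] [Module k V'] [AddCommGroup W'] [Module k W']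
    (f : V →ₗ[k] V') (g : W →ₗ[k] W') {M N : FB ⥤ FB ⥤ ModuleCat.{u} k} (η : M ⟶ N) :
    (⨁ p : ℕ × ℕ, SchurPart V W M p) →ₗ[k] ⨁ p : ℕ × ℕ, SchurPart V' W' N p :=
  DirectSum.lmap fun p => schurPartMap f g η p

theorem schurPartMap_id (M : FB ⥤ FB ⥤ ModuleCat.{u} k) (p : ℕ × ℕ) :
    schurPartMap (k := k) (LinearMap.id : V →ₗ[k] V) (LinearMap.id : W →ₗ[k] W) (𝟙 M) p =
      LinearMap.id := by
  refine Representation.Coinvariants.hom_ext (LinearMap.ext fun x => ?_)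
  change Representation.Coinvariants.mk _ (TensorProduct.map _ (TensorProduct.map _ _) x) =
    Representation.Coinvariants.mk _ x
  rw [PiTensorProduct.map_id, PiTensorProduct.map_id, NatTrans.id_app, NatTrans.id_app,
    ModuleCat.hom_id, TensorProduct.map_id, TensorProduct.map_id]
  rfl

theorem schurPartMap_comp {M N P : FB ⥤ FB ⥤ ModuleCat.{u} k} (η : M ⟶ N) (θ : N ⟶ P)
    (p : ℕ × ℕ) :
    schurPartMap (k := k) (LinearMap.id : V →ₗ[k] V) (LinearMap.id : W →ₗ[k] W) (η ≫ θ) p =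
      schurPartMap LinearMap.id LinearMap.id θ p ∘ₗ
        schurPartMap LinearMap.id LinearMap.id η p := by
  refine Representation.Coinvariants.hom_ext (LinearMap.ext fun x => ?_)
  change Representation.Coinvariants.mk _ (TensorProduct.map _ (TensorProduct.map _ _) x) =
    Representation.Coinvariants.mk _ (TensorProduct.map _ (TensorProduct.map _ _)
      (TensorProduct.map _ (TensorProduct.map _ _) x))
  rw [← LinearMap.comp_apply (TensorProduct.map _ _), ← TensorProduct.map_comp,
    ← TensorProduct.map_comp, PiTensorProduct.map_id, PiTensorProduct.map_id,
    LinearMap.comp_id, LinearMap.comp_id]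
  rfl

/-- The Schur bifunctor construction at `(V, W)`, as a functor of the bimodule `M`:
`M ↦ ⨁_{a, b} W^{⊗b} ⊗_{S_b} M(b, a) ⊗_{S_a} V^{⊗a}`. -/
def schur : (FB ⥤ FB ⥤ ModuleCat.{u} k) ⥤ ModuleCat.{u} k where
  obj M := ModuleCat.of k (⨁ p : ℕ × ℕ, SchurPart V W M p)
  map η := ModuleCat.ofHom (schurMap LinearMap.id LinearMap.id η)
  map_id M := by
    refine ModuleCat.hom_ext (LinearMap.ext fun x => DFinsupp.ext fun p => ?_)
    exact DFunLike.congr_fun (schurPartMap_id V W M p) (x p)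
  map_comp η θ := by
    refine ModuleCat.hom_ext (LinearMap.ext fun x => DFinsupp.ext fun p => ?_)
    exact DFunLike.congr_fun (schurPartMap_comp V W η θ p) (x p)

instance : (schur (k := k) V W).PreservesZeroMorphisms where
  map_zero M N := by
    have h : ∀ p, schurPartMap (k := k) (LinearMap.id : V →ₗ[k] V) (LinearMap.id : W →ₗ[k] W)
        (0 : M ⟶ N) p = 0 := fun p => by
      refine Representation.Coinvariants.hom_ext (LinearMap.ext fun y => ?_)
      change Representation.Coinvariants.mk _ (TensorProduct.map _ (TensorProduct.map 0 _) y) = 0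
      rw [TensorProduct.map_zero_left, TensorProduct.map_zero_right, LinearMap.zero_apply,
        map_zero]
    refine ModuleCat.hom_ext (LinearMap.ext fun x => DFinsupp.ext fun p => ?_)
    exact DFunLike.congr_fun (h p) (DFinsupp.toFun (show (⨁ p : ℕ × ℕ, SchurPart V W M p) from x) p)

variable (k) in
/-- The complex `Kz_• k hom_FI(-, -)(V, W)` of Schur bifunctors. -/
def schurKoszul : ChainComplex (ModuleCat.{u} k) ℕ :=
  ((schur V W).mapHomologicalComplex (ComplexShape.down ℕ)).obj (koszulHom k)

variable (k) in
/-- The polynomial bidegree `(a, b)` part of `Kz_n k hom_FI(-, -)(V, W)`. -/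
def schurKoszulBideg (n a b : ℕ) : Submodule k ((schurKoszul k V W).X n) :=
  LinearMap.range
    (DirectSum.lof k (ℕ × ℕ) (fun p => SchurPart V W ((koszulHom k).X n) p) (a, b))

variable (k) {V W} in
/-- The functoriality of `Kz_n k hom_FI(-, -)(V, W)` in `(V, W)`. -/
def schurKoszulMap {V' W' : Type u} [AddCommGroup V'] [Module k V'] [AddCommGroup W']
    [Module k W'] (f : V →ₗ[k] V') (g : W →ₗ[k] W') (n : ℕ) :
    (schurKoszul k V W).X n ⟶ (schurKoszul k V' W').X n :=
  ModuleCat.ofHom (schurMap f g (𝟙 ((koszulHom k).X n)))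

end Schur

section TargetStructure

variable {k : Type u} [CommRing k] (V W : Type u) [AddCommGroup V] [Module k V]
  [AddCommGroup W] [Module k W]

/-- The homogeneous part `S^i(Z)` of the symmetric algebra. -/
def symPow (k : Type u) [CommRing k] (Z : Type u) [AddCommGroup Z] [Module k Z] (i : ℕ) :
    Submodule k (SymmetricAlgebra k Z) :=
  LinearMap.range (SymmetricAlgebra.ι k Z) ^ i

variable (k) in
/-- The part `S^{b-a+n}(W) ⊗ Λ^n(V) ⊗ S^{a-n}(W ⊗ V)` of polynomial bidegree `(a, b)`; it is zero
unless `n ≤ a ≤ b + n`. -/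
def symExtBideg (n a b : ℕ) : Submodule k (SymExtTerm k V W n) :=
  Submodule.span k {x | ∃ i j : ℕ, i + a = b + n ∧ j + n = a ∧
    ∃ s ∈ symPow k W i, ∃ ω : ExtPow k V n, ∃ p ∈ symPow k (W ⊗[k] V) j, x = s ⊗ₜ (ω ⊗ₜ p)}

/-- The functoriality of the symmetric algebra. -/
def symMap {Z Z' : Type u} [AddCommGroup Z] [Module k Z] [AddCommGroup Z'] [Module k Z']
    (f : Z →ₗ[k] Z') : SymmetricAlgebra k Z →ₗ[k] SymmetricAlgebra k Z' :=
  (SymmetricAlgebra.lift (SymmetricAlgebra.ι k Z' ∘ₗ f)).toLinearMap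

variable {V W} in
/-- The functoriality of `S^*(W) ⊗ Λ^n(V) ⊗ S^*(W ⊗ V)` in `(V, W)`. -/
def symExtMap {V' W' : Type u} [AddCommGroup V'] [Module k V'] [AddCommGroup W']
    [Module k W'] (f : V →ₗ[k] V') (g : W →ₗ[k] W') (n : ℕ) :
    SymExtTerm k V W n →ₗ[k] SymExtTerm k V' W' n :=
  TensorProduct.map (symMap g) (TensorProduct.map (extMap n f) (symMap (TensorProduct.map g f)))

end TargetStructure

end FIKoszul

end

open FIKoszul

/-!
In bidegree `(a, b)` the isomorphism is an evaluation map. A generator of the Schur bifunctor of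
`Kz_n k hom(-, -)` consists of vectors `w₁, …, w_b` and `v₁, …, v_a`, an `n`-element subset `A` of
`{1, …, a}`, an element `ω` of `Λ^n(k A)`, and an injection `f` from the complement of `A` to
`{1, …, b}`. It is sent to

  `∏_{j ∉ im f} w_j ⊗ Λ^n(v|_A)(ω) ⊗ ∏_{x ∉ A} (w_{f x} ⊗ v_x)`

(`genValue`). This is multilinear in the vectors because `Λ^n(k A)` is a line (`evalLinear`), and it
is unchanged by simultaneous permutations of the data (`genValue_map`), so it descends to the
coinvariants (`evalSchur`). Naturality in `V` and `W` is immediate from the formula.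

The differentials correspond to each other (`evalMap_koszulD`): the Koszul differential sums over
the elements `x` of `A` and over the extensions of `f` to `x`. An extension is the choice of a value
`y` outside the image of `f`, and it moves `w_y` and `v_x` from the first two factors to the factor
`w_y ⊗ v_x` of the third one, which is what the two coproducts followed by the product do.

For bijectivity, products of vectors are visibly in the image (`range_evalSchur`,
`evalTotal_surjective`). For injectivity (`evalTotal_injective`) bases of `V` and `W` are chosen.
The generators whose vectors are basis vectors span the source, and each is sent to zero or, up to
sign, to an element of the monomial basis of the target. If it is sent to zero, two of the vectors
indexed by `A` agree and exchanging them shows that the generator equals its own opposite, hence is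
zero as `2` is invertible (`GenDatum.gen_eq_zero`). If two generators are sent to multiples of the
same monomial, equality of the multisets of basis vectors provides permutations which carry one
generator to the other up to sign (`GenDatum.gen_proportional`). A map with these properties is
injective (`injective_of_monomial`).

Finally, multiplication by an element of `S^*(W ⊗ V)` is an endomorphism of the target complex.
Transporting it along the isomorphism and taking the induced map on homology gives the module
structure (`homologyModule`).
-/

noncomputable section

namespace FIKoszul

/-! ### Multilinear and alternating preliminaries -/

section Prelim

/-- A function of several vectors whose restriction to each variable is a linear map. -/
def multilinearOfLinear {k ι M N : Type*} [CommRing k] [AddCommGroup M] [Module k M]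
    [AddCommGroup N] [Module k N] (F : (ι → M) → N)
    (h : ∀ (w : ι → M) (i : ι), ∃ L : M →ₗ[k] N,
      ∀ [DecidableEq ι] (c : M), F (Function.update w i c) = L c) :
    MultilinearMap k (fun _ : ι => M) N where
  toFun := F
  map_update_add' w i x y := by
    obtain ⟨L, hL⟩ := h w i
    rw [hL, hL, hL, map_add]
  map_update_smul' w i c x := by
    obtain ⟨L, hL⟩ := h w i
    rw [hL, hL, map_smul]

variable {k : Type u} [CommRing k] {Z : Type u} [AddCommGroup Z] [Module k Z]

/-- The product `∏ i, zᵢ` of a finite family of elements of `Z` in the symmetric algebra. -/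
def symProd {ι : Type*} [Finite ι] :
    MultilinearMap k (fun _ : ι => Z) (SymmetricAlgebra k Z) :=
  letI := Fintype.ofFinite ι
  (MultilinearMap.mkPiAlgebra k ι (SymmetricAlgebra k Z)).compLinearMap
    fun _ => SymmetricAlgebra.ι k Z

theorem symProd_eq_prod {ι : Type*} [Fintype ι] (z : ι → Z) :
    symProd (k := k) z = ∏ i, SymmetricAlgebra.ι k Z (z i) := by
  simp only [symProd, MultilinearMap.compLinearMap_apply, MultilinearMap.mkPiAlgebra_apply]
  congr!

theorem symProd_comp_equiv {ι ι' : Type*} [Finite ι] [Finite ι'] (e : ι ≃ ι') (z : ι' → Z) :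
    symProd (k := k) (fun i => z (e i)) = symProd (k := k) z := by
  let := Fintype.ofFinite ι
  let := Fintype.ofFinite ι'
  rw [symProd_eq_prod, symProd_eq_prod]
  exact Fintype.prod_equiv e _ _ fun _ => rfl

theorem symMap_symProd {Z' : Type u} [AddCommGroup Z'] [Module k Z'] (f : Z →ₗ[k] Z')
    {ι : Type*} [Finite ι] (z : ι → Z) :
    symMap f (symProd (k := k) z) = symProd (k := k) fun i => f (z i) := by
  let := Fintype.ofFinite ι
  rw [symProd_eq_prod, symProd_eq_prod]
  simp [symMap, map_prod]

/-- The coproduct of a product of generators removes one generator at a time. -/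
theorem symCoprod_symProd {ι : Type*} [Fintype ι] [DecidableEq ι] (z : ι → Z) :
    symCoprod k Z (symProd (k := k) z) =
      ∑ y, symProd (k := k) (fun i : {i // i ≠ y} => z i.1) ⊗ₜ[k] z y := by
  have key : ∀ s : Finset ι, symCoprod k Z (∏ i ∈ s, SymmetricAlgebra.ι k Z (z i)) =
      ∑ y ∈ s, (∏ i ∈ s.erase y, SymmetricAlgebra.ι k Z (z i)) ⊗ₜ[k] z y := by
    intro s
    induction s using Finset.induction_on with
    | empty => simp [symCoprod_one]
    | insert a s ha ih =>
      rw [Finset.prod_insert ha, symCoprod_ι_mul, ih, Finset.sum_insert ha,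
        Finset.erase_insert ha, map_sum, add_comm]
      congr 1
      refine Finset.sum_congr rfl fun y hy => ?_
      have hya : a ≠ y := fun h => ha (h ▸ hy)
      rw [Finset.erase_insert_of_ne hya, Finset.prod_insert fun h => ha (Finset.mem_of_mem_erase h)]
      simp
  rw [symProd_eq_prod, key]
  refine Finset.sum_congr rfl fun y _ => ?_
  rw [symProd_eq_prod]
  congr 1
  exact Finset.prod_subtype _ (fun i => by simp) _

theorem wedge_perm {V : Type u} [AddCommGroup V] [Module k V] {n : ℕ} (v : Fin n → V)
    (σ : Equiv.Perm (Fin n)) :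
    wedge k V n (v ∘ σ) = Equiv.Perm.sign σ • wedge k V n v :=
  AlternatingMap.map_perm _ _ _

/-- The top exterior power of `k A` is spanned by the product of the elements of `A`. -/
theorem exists_smul_wedge_single {A : Type} {n : ℕ} (t : Fin n ≃ A) (ω : ExtPow k (A →₀ k) n) :
    ∃ c : k, ω = c • wedge k (A →₀ k) n fun i => Finsupp.single (t i) 1 := by
  let e : Module.Basis (Fin n) k (A →₀ k) := Finsupp.basisSingleOne.reindex t.symm
  have he : ∀ i, e i = Finsupp.single (t i) 1 := fun i => by simp [e]
  have h : wedge k (A →₀ k) n =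
      (LinearMap.toSpanSingleton k (ExtPow k (A →₀ k) n) (wedge k _ n e)).compAlternatingMap
        e.det := by
    refine Module.Basis.ext_alternating e fun s hs => ?_
    obtain ⟨σ, rfl⟩ : ∃ σ : Equiv.Perm (Fin n), s = σ :=
      ⟨Equiv.ofBijective s (Finite.injective_iff_bijective.1 hs), rfl⟩
    have h₁ := wedge_perm (k := k) e σ
    have h₂ := e.det.map_perm e σ
    rw [e.det_self] at h₂
    refine h₁.trans ?_
    simp only [LinearMap.compAlternatingMap_apply, LinearMap.toSpanSingleton_apply]
    refine Eq.trans ?_ (congrArg (· • wedge k _ n e) h₂.symm)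
    rcases Int.units_eq_one_or (Equiv.Perm.sign σ) with h | h <;> simp [h]
  have h' : LinearMap.id = LinearMap.toSpanSingleton k (ExtPow k (A →₀ k) n) (wedge k _ n e) ∘ₗ
      extLift k e.det := by
    refine ext_wedge fun v => ?_
    rw [LinearMap.id_apply, LinearMap.comp_apply, extLift_wedge]
    exact DFunLike.congr_fun h v
  refine ⟨extLift k e.det ω, ?_⟩
  have := DFunLike.congr_fun h' ω
  rw [show (fun i => Finsupp.single (t i) (1 : k)) = e from funext fun i => (he i).symm]
  exact this

end Prelim

/-! ### Evaluation of the Koszul complex at vectors -/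

section Eval

variable {k : Type u} [CommRing k] {V W : Type u} [AddCommGroup V] [Module k V]
  [AddCommGroup W] [Module k W]

variable (k V W) in
/-- The trilinear map `(s, η, p) ↦ s ⊗ η ⊗ p`. -/
def symExtMk (n : ℕ) : SymmetricAlgebra k W →ₗ[k] ExtPow k V n →ₗ[k]
    SymmetricAlgebra k (W ⊗[k] V) →ₗ[k] SymExtTerm k V W n where
  toFun s := (TensorProduct.mk k (ExtPow k V n) (SymmetricAlgebra k (W ⊗[k] V))).compr₂
    (TensorProduct.mk k _ _ s)
  map_add' s t := by
    ext η p
    exact TensorProduct.add_tmul s t (η ⊗ₜ p)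
  map_smul' c s := by
    ext η p
    exact (TensorProduct.smul_tmul' c s (η ⊗ₜ p)).symm

theorem symExtMk_apply (n : ℕ) (s : SymmetricAlgebra k W) (η : ExtPow k V n)
    (p : SymmetricAlgebra k (W ⊗[k] V)) : symExtMk k V W n s η p = s ⊗ₜ (η ⊗ₜ p) := rfl

variable {n : ℕ} {X B : FB}

/-- The linear map `k A → V` sending `a` to `v a`. -/
abbrev evalLin (v : X → V) (A : Sub n X) : (A.1 →₀ k) →ₗ[k] V :=
  Finsupp.linearCombination k fun a : A.1 => v a.1

/-- The value at vectors `w : B → W` and `v : X → V` of the generator `(A, ω, f)` of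
`Kz_n k hom(-, B) (X)`: the indices outside the image of `f` contribute to `S^*(W)`, the elements
of `A` to `Λ^n(V)`, and `x ∉ A` contributes the factor `w (f x) ⊗ v x` of `S^*(W ⊗ V)`. -/
def genValue (A : Sub n X) (f : FI.compl A.1 ↪ B) (ω : ExtPow k (A.1 →₀ k) n)
    (w : B → W) (v : X → V) : SymExtTerm k V W n :=
  symExtMk k V W n (symProd fun j : {j : B // j ∉ Set.range f} => w j.1)
    (extMap n (evalLin v A) ω) (symProd fun x : FI.compl A.1 => w (f x) ⊗ₜ[k] v x.1)

theorem genValue_linear_left (A : Sub n X) (f : FI.compl A.1 ↪ B) (ω : ExtPow k (A.1 →₀ k) n)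
    (w : B → W) (v : X → V) (j : B) : ∃ L : W →ₗ[k] SymExtTerm k V W n,
      ∀ [DecidableEq B] (c : W), genValue A f ω (Function.update w j c) v = L c := by
  classical
  -- The vector `w j` occurs in exactly one factor: in the third one if `j` is in the image of `f`,
  -- in the first one otherwise.
  by_cases hj : j ∈ Set.range f
  · obtain ⟨x, rfl⟩ := hj
    refine ⟨symExtMk k V W n (symProd fun j : {j : B // j ∉ Set.range f} => w j.1)
      (extMap n (evalLin v A) ω) ∘ₗ
        symProd.toLinearMap (fun x : FI.compl A.1 => w (f x) ⊗ₜ[k] v x.1) x ∘ₗ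
          (TensorProduct.mk k W V).flip (v x.1), fun c => ?_⟩
    have h₁ : (fun j : {j : B // j ∉ Set.range f} => Function.update w (f x) c j.1) =
        fun j => w j.1 := by
      ext j
      exact Function.update_of_ne (fun h => j.2 ⟨x, h.symm⟩) _ _
    have h₂ : (fun y : FI.compl A.1 => Function.update w (f x) c (f y) ⊗ₜ[k] v y.1) =
        Function.update (fun y : FI.compl A.1 => w (f y) ⊗ₜ[k] v y.1) x (c ⊗ₜ v x.1) := by
      ext y
      by_cases h : y = x
      · subst h; simp
      · rw [Function.update_of_ne h, Function.update_of_ne fun h' => h (f.injective h')]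
    unfold genValue
    convert congrArg₂ (fun s p => symExtMk k V W n (symProd s) (extMap n (evalLin v A) ω)
      (symProd p)) h₁ h₂
    simp only [LinearMap.comp_apply, LinearMap.flip_apply, MultilinearMap.toLinearMap_apply,
      TensorProduct.mk_apply]
  · refine ⟨((symExtMk k V W n).flip (extMap n (evalLin v A) ω)).flip
      (symProd fun x : FI.compl A.1 => w (f x) ⊗ₜ[k] v x.1) ∘ₗ
        symProd.toLinearMap (fun j : {j : B // j ∉ Set.range f} => w j.1) ⟨j, hj⟩,
        fun c => ?_⟩
    have h₁ : (fun y : FI.compl A.1 => Function.update w j c (f y) ⊗ₜ[k] v y.1) =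
        fun y => w (f y) ⊗ₜ[k] v y.1 := by
      ext y
      rw [Function.update_of_ne fun h => hj ⟨y, h⟩]
    have h₂ : (fun i : {j : B // j ∉ Set.range f} => Function.update w j c i.1) =
        Function.update (fun i : {j : B // j ∉ Set.range f} => w i.1) ⟨j, hj⟩ c := by
      ext i
      by_cases h : i = ⟨j, hj⟩
      · subst h; simp
      · rw [Function.update_of_ne h, Function.update_of_ne fun h' => h (Subtype.ext h')]
    unfold genValue
    convert congrArg₂ (fun s p => symExtMk k V W n (symProd s) (extMap n (evalLin v A) ω)
      (symProd p)) h₂ h₁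
    simp only [LinearMap.comp_apply, LinearMap.flip_apply, MultilinearMap.toLinearMap_apply]
    congr!

theorem extMap_evalLin_wedge (A : Sub n X) (t : Fin n → A.1) (v : X → V) :
    extMap n (evalLin (k := k) v A) (wedge k _ n fun i => Finsupp.single (t i) 1) =
      wedge k V n fun i => v (t i).1 := by
  rw [extMap_wedge]
  congr 1
  ext i
  simp

theorem genValue_linear_right (A : Sub n X) (f : FI.compl A.1 ↪ B) (ω : ExtPow k (A.1 →₀ k) n)
    (w : B → W) (v : X → V) (x : X) : ∃ L : V →ₗ[k] SymExtTerm k V W n,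
      ∀ [DecidableEq X] (c : V), genValue A f ω w (Function.update v x c) = L c := by
  classical
  let t : Fin n ≃ A.1 := (A.1.equivFinOfCardEq A.2).symm
  -- Linearity in the vectors indexed by `A` holds because `ω` is a multiple of the product of all
  -- the elements of `A`; a smaller exterior power of `k A` would not be enough.
  obtain ⟨a, rfl⟩ := exists_smul_wedge_single t ω
  simp only [genValue, map_smul, extMap_evalLin_wedge]
  by_cases hx : x ∈ A.1
  · obtain ⟨i, hi⟩ := t.surjective ⟨x, hx⟩
    refine ⟨a • ((symExtMk k V W n (symProd fun j : {j : B // j ∉ Set.range f} => w j.1)).flip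
      (symProd fun x : FI.compl A.1 => w (f x) ⊗ₜ[k] v x.1) ∘ₗ
        (wedge k V n).toMultilinearMap.toLinearMap (fun i => v (t i).1) i), fun c => ?_⟩
    have h₁ : (fun y : FI.compl A.1 => w (f y) ⊗ₜ[k] Function.update v x c y.1) =
        fun y => w (f y) ⊗ₜ[k] v y.1 := by
      ext y
      rw [Function.update_of_ne fun h : y.1 = x => y.2 (h ▸ hx)]
    have h₂ : (fun l => Function.update v x c (t l).1) =
        Function.update (fun l => v (t l).1) i c := by
      ext l
      by_cases h : l = i
      · subst h; simp [hi]
      · rw [Function.update_of_ne h, Function.update_of_ne fun h' => h (t.injective ?_)]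
        rw [hi]
        exact Subtype.ext h'
    convert congrArg₂ (fun e p => a • symExtMk k V W n (symProd fun j : {j : B //
      j ∉ Set.range f} => w j.1) (wedge k V n e) (symProd p)) h₂ h₁
    simp only [LinearMap.smul_apply]
    congr!
  · obtain ⟨x, rfl⟩ : ∃ x' : FI.compl A.1, x'.1 = x := ⟨⟨x, hx⟩, rfl⟩
    refine ⟨a • (symExtMk k V W n (symProd fun j : {j : B // j ∉ Set.range f} => w j.1)
      (wedge k V n fun i => v (t i).1) ∘ₗ
        symProd.toLinearMap (fun x : FI.compl A.1 => w (f x) ⊗ₜ[k] v x.1) x ∘ₗ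
          TensorProduct.mk k W V (w (f x))), fun c => ?_⟩
    have h₁ : (fun y : FI.compl A.1 => w (f y) ⊗ₜ[k] Function.update v x.1 c y.1) =
        Function.update (fun y : FI.compl A.1 => w (f y) ⊗ₜ[k] v y.1) x
          (w (f x) ⊗ₜ c) := by
      ext y
      by_cases h : y = x
      · subst h; rw [Function.update_self, Function.update_self]
      · rw [Function.update_of_ne h, Function.update_of_ne fun h' => h (Subtype.ext h')]
    have h₂ : (fun l => Function.update v x.1 c (t l).1) = fun l => v (t l).1 := by
      ext l
      rw [Function.update_of_ne fun h : (t l).1 = x.1 => hx (h ▸ (t l).2)]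
    convert congrArg₂ (fun e p => a • symExtMk k V W n (symProd fun j : {j : B //
      j ∉ Set.range f} => w j.1) (wedge k V n e) (symProd p)) h₂ h₁
    simp only [LinearMap.smul_apply]
    congr!

/-- The bilinear map on tensor powers given by a function of two families of vectors which is
linear in each vector. -/
def tensorLift₂ {ι κ N : Type*} [AddCommGroup N] [Module k N] (F : (ι → W) → (κ → V) → N)
    (hw : ∀ w v i, ∃ L : W →ₗ[k] N, ∀ [DecidableEq ι] (c : W),
      F (Function.update w i c) v = L c)
    (hv : ∀ w v i, ∃ L : V →ₗ[k] N, ∀ [DecidableEq κ] (c : V),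
      F w (Function.update v i c) = L c) :
    (PiTensorProduct k fun _ : ι => W) →ₗ[k] (PiTensorProduct k fun _ : κ => V) →ₗ[k] N :=
  PiTensorProduct.lift
    { toFun := fun w => PiTensorProduct.lift (multilinearOfLinear (F w) (hv w))
      map_update_add' := fun w i x y => by
        refine PiTensorProduct.ext (MultilinearMap.ext fun v => ?_)
        obtain ⟨L, hL⟩ := hw w v i
        simp [multilinearOfLinear, hL]
      map_update_smul' := fun w i c x => by
        refine PiTensorProduct.ext (MultilinearMap.ext fun v => ?_)
        obtain ⟨L, hL⟩ := hw w v i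
        simp [multilinearOfLinear, hL] }

theorem tensorLift₂_tprod {ι κ N : Type*} [AddCommGroup N] [Module k N]
    (F : (ι → W) → (κ → V) → N) (hw) (hv) (w : ι → W) (v : κ → V) :
    tensorLift₂ (k := k) F hw hv (PiTensorProduct.tprod k w) (PiTensorProduct.tprod k v) =
      F w v := by
  simp [tensorLift₂, multilinearOfLinear]

theorem tensor₂_ext {ι κ N : Type*} [AddCommGroup N] [Module k N]
    {F G : (PiTensorProduct k fun _ : ι => W) →ₗ[k] (PiTensorProduct k fun _ : κ => V) →ₗ[k] N}
    (h : ∀ w v, F (PiTensorProduct.tprod k w) (PiTensorProduct.tprod k v) =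
      G (PiTensorProduct.tprod k w) (PiTensorProduct.tprod k v)) : F = G :=
  PiTensorProduct.ext (MultilinearMap.ext fun w =>
    PiTensorProduct.ext (MultilinearMap.ext fun v => h w v))

variable (V W) in
/-- `genValue` as a linear function of `ω`, with values in bilinear maps on tensor powers. -/
def evalLinear (A : Sub n X) (f : FI.compl A.1 ↪ B) : ExtPow k (A.1 →₀ k) n →ₗ[k]
    (PiTensorProduct k fun _ : B => W) →ₗ[k] (PiTensorProduct k fun _ : X => V) →ₗ[k]
      SymExtTerm k V W n where
  toFun ω := tensorLift₂ (genValue A f ω) (genValue_linear_left A f ω)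
    (genValue_linear_right A f ω)
  map_add' ω ω' := tensor₂_ext fun w v => by
    simp [tensorLift₂_tprod, genValue]
  map_smul' c ω := tensor₂_ext fun w v => by
    simp [tensorLift₂_tprod, genValue]

/-- The generator `(A, ω, f)` of `Kz_n k hom(-, B) (X)`. -/
def koszulGen (A : Sub n X) (ω : ExtPow k (A.1 →₀ k) n) (f : FI.compl A.1 ↪ B) :
    KoszulSpace n ((homTr k).obj B) X :=
  koszulIncl n ((homTr k).obj B) X A
    (ω ⊗ₜ[k] (show ((homTr k).obj B).obj (FI.compl A.1) from
      (Finsupp.single f 1 : (FI.compl A.1 ↪ B) →₀ k)))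

theorem koszulSpace_ext {N : Type*} [AddCommGroup N] [Module k N]
    {F G : KoszulSpace n ((homTr k).obj B) X →ₗ[k] N}
    (h : ∀ A ω f, F (koszulGen A ω f) = G (koszulGen A ω f)) : F = G := by
  classical
  refine DirectSum.linearMap_ext _ fun A => ?_
  refine TensorProduct.ext (LinearMap.ext fun ω => ?_)
  refine Finsupp.lhom_ext' (M := k) (α := FI.compl A.1 ↪ B) fun f => ?_
  refine LinearMap.ext_ring ?_
  exact h A ω f

variable (n X B V W) in
/-- The evaluation of the Koszul complex of `k hom(-, B)` on `X` at tensors. -/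
def evalMap : KoszulSpace n ((homTr k).obj B) X →ₗ[k]
    (PiTensorProduct k fun _ : B => W) →ₗ[k] (PiTensorProduct k fun _ : X => V) →ₗ[k]
      SymExtTerm k V W n :=
  letI := Classical.decEq (Sub n X)
  DirectSum.toModule k _ _ fun A => TensorProduct.lift
    (LinearMap.flip (Finsupp.linearCombination k (evalLinear V W A)))

theorem evalMap_koszulGen (A : Sub n X) (ω : ExtPow k (A.1 →₀ k) n) (f : FI.compl A.1 ↪ B)
    (w : B → W) (v : X → V) :
    evalMap V W n X B (koszulGen A ω f) (PiTensorProduct.tprod k w) (PiTensorProduct.tprod k v) =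
      genValue A f ω w v := by
  have : evalMap V W n X B (koszulGen A ω f) = evalLinear V W A f ω := by
    unfold evalMap koszulGen koszulIncl
    erw [DirectSum.toModule_lof]
    refine (TensorProduct.lift.tmul _ _).trans ?_
    change Finsupp.linearCombination k (evalLinear V W A) (Finsupp.single f 1) ω = _
    rw [Finsupp.linearCombination_single, one_smul]
  rw [this]
  exact tensorLift₂_tprod _ (genValue_linear_left A f ω) (genValue_linear_right A f ω) w v

end Eval

/-! ### The structure maps on generators -/

section Generators

variable {k : Type u} [CommRing k] {n : ℕ} {X Y B B' : FB}

theorem Sub.exists_extend_map (e : X ≃ Y) (A : Sub n X) (f : FI.compl A.1 ↪ B) :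
    ∃ f' : FI.compl (A.map e).1 ↪ B, ∀ x : FI.compl A.1, f' ((A.complMap e).toFun x) = f x := by
  have h : ∀ y : FI.compl (A.map e).1, e.symm y.1 ∉ A.1 := fun y hy =>
    y.2 (Finset.mem_map_equiv.2 hy)
  refine ⟨⟨fun y => f ⟨e.symm y.1, h y⟩, fun y y' hy => Subtype.ext ?_⟩, fun x => ?_⟩
  · exact e.symm.injective (congrArg (fun z : FI.compl A.1 => z.1) (f.injective hy))
  · exact congrArg f (Subtype.ext (e.symm_apply_apply x.1))

theorem Sub.complMap_surjective (e : X ≃ Y) (A : Sub n X) :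
    Function.Surjective (A.complMap e).toFun := fun y =>
  ⟨⟨e.symm y.1, fun hy => y.2 (Finset.mem_map_equiv.2 hy)⟩,
    Subtype.ext (e.apply_symm_apply y.1)⟩

theorem koszulMap_koszulGen (e : X ≃ Y) (A : Sub n X) (ω : ExtPow k (A.1 →₀ k) n)
    (f : FI.compl A.1 ↪ B) (f' : FI.compl (A.map e).1 ↪ B)
    (hf : ∀ x : FI.compl A.1, f' ((A.complMap e).toFun x) = f x) :
    koszulMap n ((homTr k).obj B) e (koszulGen A ω f) =
      koszulGen (A.map e) (extMap n (freeMap e A) ω) f' := by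
  refine (DFunLike.congr_fun (koszulMap_incl n ((homTr k).obj B) e A) _).trans ?_
  refine congrArg (koszulIncl n ((homTr k).obj B) Y (A.map e)) ?_
  refine (TensorProduct.map_tmul _ _ _ _).trans (congrArg _ ?_)
  change trMap k B (A.complMap e) (Finsupp.single f 1) = Finsupp.single f' 1
  classical
  ext g
  rw [trMap_apply, Finsupp.single_apply, Finsupp.single_apply]
  refine if_congr ⟨fun h => ?_, fun h => ?_⟩ rfl rfl
  · ext y
    obtain ⟨x, rfl⟩ := A.complMap_surjective e y
    rw [hf, h]
    rfl
  · ext x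
    rw [← hf, h]
    rfl

theorem koszulNat_koszulGen (σ : B ⟶ B') (A : Sub n X) (ω : ExtPow k (A.1 →₀ k) n)
    (f : FI.compl A.1 ↪ B) :
    koszulNat n ((homTr k).map σ) X (koszulGen A ω f) =
      koszulGen A ω (f.trans (show B ≃ B' from σ).toEmbedding) := by
  refine (DFunLike.congr_fun (koszulNat_incl n ((homTr k).map σ) X A) _).trans ?_
  refine congrArg (koszulIncl n ((homTr k).obj B') X A) ?_
  refine (TensorProduct.map_tmul _ _ _ _).trans (congrArg _ ?_)
  exact Finsupp.mapDomain_single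

open scoped Classical in
theorem koszulD_koszulGen (A : Sub (n + 1) X) (ω : ExtPow k (A.1 →₀ k) (n + 1))
    (f : FI.compl A.1 ↪ B) :
    koszulD n ((homTr k).obj B) X (koszulGen A ω f) = ∑ x : A.1,
      ∑ f' ∈ (Set.toFinite {f' : FI.compl (A.erase x).1 ↪ B |
        (A.complErase x).trans f' = f}).toFinset,
      koszulGen (A.erase x) (contr n (Finsupp.lapply x) (freeRes A x) ω) f' := by
  refine (DFunLike.congr_fun (koszulD_incl n ((homTr k).obj B) X A) _).trans ?_
  rw [LinearMap.sum_apply]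
  refine Finset.sum_congr rfl fun x _ => ?_
  let L : ((FI.compl (A.erase x).1 ↪ B) →₀ k) →ₗ[k] KoszulSpace n ((homTr k).obj B) X :=
    koszulIncl n ((homTr k).obj B) X (A.erase x) ∘ₗ
      TensorProduct.mk k _ (((homTr k).obj B).obj (FI.compl (A.erase x).1))
        (contr n (Finsupp.lapply x) (freeRes A x) ω)
  change L (trMap k B (A.complErase x) (Finsupp.single f 1)) = _
  rw [trMap, Finsupp.linearCombination_single, one_smul, map_sum]
  rfl

variable {V W : Type u} [AddCommGroup V] [Module k V] [AddCommGroup W] [Module k W]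

/-- The evaluation is unchanged by simultaneous bijections of all the data. -/
theorem genValue_map (e : X ≃ Y) (σ : B ≃ B') (A : Sub n X) (ω : ExtPow k (A.1 →₀ k) n)
    (f : FI.compl A.1 ↪ B) (f' : FI.compl (A.map e).1 ↪ B')
    (hf : ∀ x : FI.compl A.1, f' ((A.complMap e).toFun x) = σ (f x))
    (w : B → W) (w' : B' → W) (hw : ∀ j, w' (σ j) = w j)
    (v : X → V) (v' : Y → V) (hv : ∀ x, v' (e x) = v x) :
    genValue (A.map e) f' (extMap n (freeMap e A) ω) w' v' = genValue A f ω w v := by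
  have h₁ : (symProd fun j : {j : B // j ∉ Set.range f} => w j.1) =
      symProd (k := k) fun j : {j : B' // j ∉ Set.range f'} => w' j.1 := by
    let E : {j : B // j ∉ Set.range f} ≃ {j : B' // j ∉ Set.range f'} :=
      σ.subtypeEquiv fun j => not_congr ⟨?_, ?_⟩
    · rw [← symProd_comp_equiv E]
      exact congrArg _ (funext fun j => (hw j.1).symm)
    · rintro ⟨x, rfl⟩
      exact ⟨_, hf x⟩
    · rintro ⟨y, hy⟩
      obtain ⟨x, rfl⟩ := A.complMap_surjective e y
      exact ⟨x, σ.injective ((hf x).symm.trans hy)⟩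
  have h₂ : (symProd fun x : FI.compl A.1 => w (f x) ⊗ₜ[k] v x.1) =
      symProd (k := k) fun y : FI.compl (A.map e).1 => w' (f' y) ⊗ₜ[k] v' y.1 := by
    rw [← symProd_comp_equiv (Equiv.ofBijective (A.complMap e).toFun
      ⟨(A.complMap e).injective, A.complMap_surjective e⟩)]
    refine congrArg _ (funext fun x => ?_)
    change _ = w' (f' ((A.complMap e).toFun x)) ⊗ₜ[k] v' (e x.1)
    rw [hf, hw, hv]
  have h₃ : evalLin (k := k) v' (A.map e) ∘ₗ freeMap e A = evalLin v A := by
    ext a : 2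
    simp only [LinearMap.comp_apply, Finsupp.lsingle_apply, freeMap_single]
    simp [hv]
  have h₄ : extMap n (evalLin v' (A.map e)) (extMap n (freeMap e A) ω) =
      extMap n (evalLin v A) ω := by
    rw [← LinearMap.comp_apply, ← extMap_comp, h₃]
  unfold genValue
  rw [h₁, h₂, h₄]

end Generators

/-! ### Generators of the Schur bifunctor -/

section SchurGen

variable {k : Type u} [CommRing k] {V W : Type u} [AddCommGroup V] [Module k V]
  [AddCommGroup W] [Module k W] {n a b : ℕ}

variable (k n) in
/-- The bifunctor `Kz_n k hom(-, -)`. -/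
abbrev koszulBimod : FB ⥤ FB ⥤ ModuleCat.{u} k := homTr k ⋙ koszulTerm k n

/-- The generator `(A, ω, f)` as an element of the value of the bifunctor. -/
def bimodGen (A : Sub n (FB.fin a)) (ω : ExtPow k (A.1 →₀ k) n) (f : FI.compl A.1 ↪ FB.fin b) :
    ((koszulBimod k n).obj (FB.fin b)).obj (FB.fin a) :=
  koszulGen A ω f

/-- The class of `w₁ ⊗ ⋯ ⊗ w_b ⊗ (A, ω, f) ⊗ v₁ ⊗ ⋯ ⊗ v_a` in the bidegree `(a, b)` part of the
Schur bifunctor of `Kz_n k hom(-, -)`. -/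
def schurGen (A : Sub n (FB.fin a)) (ω : ExtPow k (A.1 →₀ k) n) (f : FI.compl A.1 ↪ FB.fin b)
    (w : Fin b → W) (v : Fin a → V) : SchurPart V W (koszulBimod k n) (a, b) :=
  Representation.Coinvariants.mk (schurRep V W (koszulBimod k n) a b)
    (PiTensorProduct.tprod k w ⊗ₜ[k]
      (bimodGen A ω f ⊗ₜ[k] PiTensorProduct.tprod k v))

/-- Linear maps on the bidegree `(a, b)` part agree if they agree on the generators. -/
theorem schurPart_ext {N : Type*} [AddCommGroup N] [Module k N]
    {F G : SchurPart V W (koszulBimod k n) (a, b) →ₗ[k] N}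
    (h : ∀ A ω f w v, F (schurGen A ω f w v) = G (schurGen A ω f w v)) : F = G := by
  refine Representation.Coinvariants.hom_ext ?_
  refine TensorProduct.ext (PiTensorProduct.ext (MultilinearMap.ext fun w => ?_))
  refine TensorProduct.ext (koszulSpace_ext (X := FB.fin a) (B := FB.fin b) fun A ω f => ?_)
  exact PiTensorProduct.ext (MultilinearMap.ext fun v => h A ω f w v)

theorem bimodAct_bimodGen (σ : FB.fin b ≃ FB.fin b) (τ : FB.fin a ≃ FB.fin a)
    (A : Sub n (FB.fin a)) (ω : ExtPow k (A.1 →₀ k) n) (f : FI.compl A.1 ↪ FB.fin b)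
    (f' : FI.compl (A.map τ).1 ↪ FB.fin b)
    (hf : ∀ x : FI.compl A.1, f' ((A.complMap τ).toFun x) = σ (f x)) :
    bimodAct (koszulBimod k n) a b (σ, τ) (bimodGen A ω f) =
      bimodGen (A.map τ) (extMap n (freeMap τ A) ω) f' := by
  obtain ⟨f₁, hf₁⟩ := A.exists_extend_map τ f
  have hf' : f' = f₁.trans σ.toEmbedding := by
    ext y
    obtain ⟨x, rfl⟩ := A.complMap_surjective τ y
    rw [hf]
    exact (congrArg σ (hf₁ x)).symm
  change koszulNat n ((homTr k).map (show FB.fin b ⟶ FB.fin b from σ)) (FB.fin a)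
    (koszulMap n ((homTr k).obj (FB.fin b)) τ (koszulGen A ω f)) =
      koszulGen (A.map τ) (extMap n (freeMap τ A) ω) f'
  rw [koszulMap_koszulGen τ A ω f f₁ hf₁, hf']
  exact koszulNat_koszulGen _ _ _ _

theorem koszulGen_congr {X B : FB} {A A' : Sub n X} (h : A = A')
    {ω : ExtPow k (A.1 →₀ k) n} {ω' : ExtPow k (A'.1 →₀ k) n}
    (hω : extMap n (freeIncl A) ω = extMap n (freeIncl A') ω') {f : FI.compl A.1 ↪ B}
    {f' : FI.compl A'.1 ↪ B} (hf : ∀ x y, x.1 = y.1 → f x = f' y) :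
    koszulGen A ω f = koszulGen A' ω' f' := by
  subst h
  rw [extMap_freeIncl_injective A hω, show f = f' from Function.Embedding.ext fun x => hf x x rfl]

/-- Simultaneous permutations of all the data do not change the class of a generator. -/
theorem schurGen_eq (σ : FB.fin b ≃ FB.fin b) (τ : FB.fin a ≃ FB.fin a)
    {A A' : Sub n (FB.fin a)} (hA : A.map τ = A')
    {ω : ExtPow k (A.1 →₀ k) n} {ω' : ExtPow k (A'.1 →₀ k) n}
    (hω : extMap n (Finsupp.lmapDomain k k τ ∘ₗ freeIncl A) ω = extMap n (freeIncl A') ω')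
    {f : FI.compl A.1 ↪ FB.fin b} {f' : FI.compl A'.1 ↪ FB.fin b}
    (hf : ∀ x y, τ x.1 = y.1 → f' y = σ (f x))
    {w w' : Fin b → W} (hw : ∀ j, w' (σ j) = w j) {v v' : Fin a → V} (hv : ∀ x, v' (τ x) = v x) :
    schurGen A ω f w v = schurGen A' ω' f' w' v' := by
  subst hA
  unfold schurGen
  rw [← Representation.Coinvariants.mk_self_apply _
    ((σ, τ) : Equiv.Perm (Fin b) × Equiv.Perm (Fin a))]
  congr 1
  change TensorProduct.map (placePerm σ) (TensorProduct.map (bimodAct (koszulBimod k n) a b (σ, τ))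
    (placePerm τ)) _ = _
  rw [TensorProduct.map_tmul, TensorProduct.map_tmul]
  have h₁ : (fun i => w (σ.symm i)) = w' := funext fun i =>
    (hw _).symm.trans (congrArg w' (σ.apply_symm_apply i))
  have h₂ : (fun i => v (τ.symm i)) = v' := funext fun i =>
    (hv _).symm.trans (congrArg v' (τ.apply_symm_apply i))
  refine congrArg₂ _ ((placePerm_tprod _ _).trans (congrArg _ h₁))
    (congrArg₂ _ ?_ ((placePerm_tprod _ _).trans (congrArg _ h₂)))
  refine (bimodAct_bimodGen σ τ A ω f f' fun x => hf x _ rfl).trans ?_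
  refine koszulGen_congr rfl ?_ fun x y h => by rw [Subtype.ext h]
  rw [← hω, ← LinearMap.comp_apply, ← extMap_comp, freeIncl_freeMap]

/-- The evaluation map on the bidegree `(a, b)` part of the Schur bifunctor. -/
def evalSchur (k : Type u) [CommRing k] (V W : Type u) [AddCommGroup V] [Module k V]
    [AddCommGroup W] [Module k W] (n a b : ℕ) :
    SchurPart V W (koszulBimod k n) (a, b) →ₗ[k] SymExtTerm k V W n :=
  Representation.Coinvariants.lift _
    (TensorProduct.lift ((TensorProduct.uncurry (RingHom.id k)
      (KoszulSpace n ((homTr k).obj (FB.fin b)) (FB.fin a)) (TPow k V a) (SymExtTerm k V W n)) ∘ₗ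
        (evalMap V W n (FB.fin a) (FB.fin b)).flip)) fun ⟨σ, τ⟩ => by
    refine TensorProduct.ext (PiTensorProduct.ext (MultilinearMap.ext fun w => ?_))
    refine TensorProduct.ext (koszulSpace_ext (X := FB.fin a) (B := FB.fin b) fun A ω f => ?_)
    refine PiTensorProduct.ext (MultilinearMap.ext fun v => ?_)
    obtain ⟨f₁, hf₁⟩ := A.exists_extend_map (show FB.fin a ≃ FB.fin a from τ)
      (f.trans (show FB.fin b ≃ FB.fin b from σ).toEmbedding)
    change evalMap V W n (FB.fin a) (FB.fin b)
      (bimodAct (koszulBimod k n) a b (σ, τ) (bimodGen A ω f))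
      (placePerm σ (PiTensorProduct.tprod k w)) (placePerm τ (PiTensorProduct.tprod k v)) =
      evalMap V W n (FB.fin a) (FB.fin b) (koszulGen A ω f)
        (PiTensorProduct.tprod k w) (PiTensorProduct.tprod k v)
    rw [placePerm_tprod, placePerm_tprod]
    refine (congrArg (fun z => evalMap V W n (FB.fin a) (FB.fin b) z _ _)
      (bimodAct_bimodGen σ τ A ω f f₁ hf₁)).trans ?_
    refine (evalMap_koszulGen _ _ _ _ _).trans
      (Eq.trans ?_ (evalMap_koszulGen A ω f w v).symm)
    exact genValue_map (X := FB.fin a) (Y := FB.fin a) (B := FB.fin b) (B' := FB.fin b) τ σ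
      A ω f f₁ hf₁ w (fun i => w (σ.symm i)) (fun j => congrArg w (σ.symm_apply_apply j))
      v (fun i => v (τ.symm i))
      (fun j => congrArg v (τ.symm_apply_apply j))

theorem evalSchur_schurGen (A : Sub n (FB.fin a)) (ω : ExtPow k (A.1 →₀ k) n)
    (f : FI.compl A.1 ↪ FB.fin b) (w : Fin b → W) (v : Fin a → V) :
    evalSchur k V W n a b (schurGen A ω f w v) = genValue (X := FB.fin a) (B := FB.fin b)
      A f ω w v :=
  evalMap_koszulGen (X := FB.fin a) (B := FB.fin b) A ω f w v

/-- The evaluation map on the Schur bifunctor of `Kz_n k hom(-, -)`. -/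
def evalTotal (k : Type u) [CommRing k] (V W : Type u) [AddCommGroup V] [Module k V]
    [AddCommGroup W] [Module k W] (n : ℕ) :
    (⨁ p : ℕ × ℕ, SchurPart V W (koszulBimod k n) p) →ₗ[k] SymExtTerm k V W n :=
  DirectSum.toModule k _ _ fun p => evalSchur k V W n p.1 p.2

end SchurGen

/-! ### Compatibility with the differentials -/

section Differential

variable {k : Type u} [CommRing k] {V W : Type u} [AddCommGroup V] [Module k V]
  [AddCommGroup W] [Module k W] {n : ℕ} {X B : FB}

theorem symProd_option {Z : Type u} [AddCommGroup Z] [Module k Z] {ι : Type*} [Finite ι]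
    (z : Option ι → Z) : symProd (k := k) z =
      SymmetricAlgebra.ι k Z (z none) * symProd (k := k) fun i => z (some i) := by
  let := Fintype.ofFinite ι
  rw [symProd_eq_prod, symProd_eq_prod, Fintype.prod_option]

/-- The coproduct of an exterior power of vectors indexed by `A`, as a sum over the elements
of `A`. -/
theorem extCoprod_extMap_evalLin (A : Sub (n + 1) X) (v : X → V)
    (ω : ExtPow k (A.1 →₀ k) (n + 1)) :
    extCoprod k V n (extMap (n + 1) (evalLin v A) ω) =
      ∑ x : A.1, extMap n (evalLin v (A.erase x))
        (contr n (Finsupp.lapply x) (freeRes A x) ω) ⊗ₜ[k] v x.1 := by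
  classical
  let t : Fin (n + 1) ≃ A.1 := (A.1.equivFinOfCardEq A.2).symm
  obtain ⟨c, rfl⟩ := exists_smul_wedge_single t ω
  simp only [map_smul, ← TensorProduct.smul_tmul', ← Finset.smul_sum]
  congr 1
  rw [extMap_evalLin_wedge, extCoprod_wedge, ← t.sum_comp, Finset.smul_sum]
  refine Finset.sum_congr rfl fun i _ => ?_
  rw [← LinearMap.comp_apply, extMap_comp_contr, contr, LinearMap.comp_apply,
    LinearMap.comp_apply, extCoprod_wedge]
  simp only [map_smul, map_sum, TensorProduct.map_tmul, ← TensorProduct.smul_tmul']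
  congr 1
  rw [TensorProduct.smul_tmul']
  congr 1
  rw [Finset.sum_eq_single i]
  -- Only the term which removes the position of `x` survives, since `lapply x` kills the other
  -- basis vectors of `k A`.
  · simp only [Finsupp.lapply_apply, Finsupp.single_eq_same, LinearEquiv.coe_coe,
      TensorProduct.rid_tmul, one_smul, extMap_wedge]
    congr 2
    ext j
    simp only [Function.comp_apply, Fin.removeNth_apply, LinearMap.comp_apply]
    rw [freeRes_of_ne]
    · simp
    · exact fun h => Fin.succAbove_ne i j (t.injective (Subtype.ext h))
  · intro j _ hj
    simp [Finsupp.single_eq_of_ne (fun h => hj (t.injective h).symm)]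
  · simp

theorem symExtD_symExtMk (s : SymmetricAlgebra k W) (η : ExtPow k V (n + 1))
    (p : SymmetricAlgebra k (W ⊗[k] V)) :
    symExtD k V W n (symExtMk k V W (n + 1) s η p) =
      regroupMul k V W (SymmetricAlgebra k W) (ExtPow k V n)
        (symCoprod k W s ⊗ₜ (extCoprod k V n η ⊗ₜ p)) := rfl

/-- The element `x` of `A`, as an element of the complement of `A ∖ {x}`. -/
def Sub.erased (A : Sub (n + 1) X) (x : A.1) : FI.compl (A.erase x).1 :=
  ⟨x.1, by classical exact Finset.notMem_erase _ _⟩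

theorem Sub.compl_erase_cases (A : Sub (n + 1) X) (x : A.1) (z : FI.compl (A.erase x).1) :
    z = A.erased x ∨ ∃ y, z = (A.complErase x).toFun y := by
  classical
  by_cases h : z.1 = x.1
  · exact Or.inl (Subtype.ext h)
  · exact Or.inr ⟨⟨z.1, fun hz => z.2 (Finset.mem_erase.2 ⟨h, hz⟩)⟩, rfl⟩

theorem Sub.complErase_ne (A : Sub (n + 1) X) (x : A.1) (y : FI.compl A.1) :
    (A.complErase x).toFun y ≠ A.erased x := fun h =>
  y.2 ((show y.1 = x.1 from congrArg Subtype.val h) ▸ x.2)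

variable {A : Sub (n + 1) X} {x : A.1} {f : FI.compl A.1 ↪ B}
  {f' : FI.compl (A.erase x).1 ↪ B}

theorem extend_apply (hf : (A.complErase x).trans f' = f) (y : FI.compl A.1) :
    f' ((A.complErase x).toFun y) = f y := by
  rw [← hf]; rfl

theorem extend_erased_notMem (hf : (A.complErase x).trans f' = f) :
    f' (A.erased x) ∉ Set.range f := by
  rintro ⟨y, hy⟩
  rw [← extend_apply hf] at hy
  exact A.complErase_ne x y (f'.injective hy)

/-- An extension of `f` to `x` takes one index from the `S^*(W)`-factor and multiplies the
`S^*(W ⊗ V)`-factor by the corresponding generator. -/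
theorem genValue_extend (hf : (A.complErase x).trans f' = f) (ω : ExtPow k ((A.erase x).1 →₀ k) n)
    (w : B → W) (v : X → V) (y : {j : B // j ∉ Set.range f}) (hy : f' (A.erased x) = y.1) :
    genValue (A.erase x) f' ω w v = symExtMk k V W n
      (symProd fun i : {i : {j : B // j ∉ Set.range f} // i ≠ y} => w i.1.1)
      (extMap n (evalLin v (A.erase x)) ω)
      (SymmetricAlgebra.ι k _ (w y.1 ⊗ₜ v x.1) *
        symProd fun z : FI.compl A.1 => w (f z) ⊗ₜ[k] v z.1) := by
  have h₁ : (symProd fun j : {j : B // j ∉ Set.range f'} => w j.1) =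
      symProd (k := k) fun i : {i : {j : B // j ∉ Set.range f} // i ≠ y} => w i.1.1 := by
    let E : {j : B // j ∉ Set.range f'} → {i : {j : B // j ∉ Set.range f} // i ≠ y} := fun j =>
      ⟨⟨j.1, fun ⟨z, hz⟩ => j.2 ⟨_, (extend_apply hf z).trans hz⟩⟩, fun h =>
        j.2 ⟨A.erased x, hy.trans (congrArg Subtype.val h).symm⟩⟩
    have hE : Function.Bijective E := by
      refine ⟨fun i j h => Subtype.ext (congrArg (fun z => z.1.1) h), fun i => ?_⟩
      refine ⟨⟨i.1.1, ?_⟩, rfl⟩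
      rintro ⟨z, hz⟩
      rcases A.compl_erase_cases x z with rfl | ⟨z, rfl⟩
      · exact i.2 (Subtype.ext (hz.symm.trans hy))
      · exact i.1.2 ⟨z, (extend_apply hf z).symm.trans hz⟩
    rw [← symProd_comp_equiv (Equiv.ofBijective E hE)]
    rfl
  have h₂ : (symProd fun z : FI.compl (A.erase x).1 => w (f' z) ⊗ₜ[k] v z.1) =
      SymmetricAlgebra.ι k _ (w y.1 ⊗ₜ v x.1) *
        symProd (k := k) fun z : FI.compl A.1 => w (f z) ⊗ₜ[k] v z.1 := by
    let E : Option (FI.compl A.1) → FI.compl (A.erase x).1 := fun o =>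
      o.elim (A.erased x) (A.complErase x).toFun
    have hE : Function.Bijective E := by
      constructor
      · rintro (_ | i) (_ | j) h
        · rfl
        · exact (A.complErase_ne x j h.symm).elim
        · exact (A.complErase_ne x i h).elim
        · exact congrArg some ((A.complErase x).injective h)
      · intro z
        rcases A.compl_erase_cases x z with rfl | ⟨z, rfl⟩
        · exact ⟨none, rfl⟩
        · exact ⟨some z, rfl⟩
    rw [← symProd_comp_equiv (Equiv.ofBijective E hE), symProd_option]
    refine congrArg₂ (fun a b => SymmetricAlgebra.ι k (W ⊗[k] V) a * symProd b) ?_ ?_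
    · exact congrArg (fun j => w j ⊗ₜ[k] v x.1) hy
    · exact funext fun z => congrArg (fun j => w j ⊗ₜ[k] v z.1) (extend_apply hf z)
  unfold genValue
  rw [h₁, h₂]

theorem exists_extend (A : Sub (n + 1) X) (x : A.1) (f : FI.compl A.1 ↪ B)
    (y : {j : B // j ∉ Set.range f}) : ∃ f' : FI.compl (A.erase x).1 ↪ B,
      (A.complErase x).trans f' = f ∧ f' (A.erased x) = y.1 := by
  classical
  have hz : ∀ z : FI.compl (A.erase x).1, z ≠ A.erased x → z.1 ∉ A.1 := fun z h hz =>
    z.2 (Finset.mem_erase.2 ⟨fun h' => h (Subtype.ext h'), hz⟩)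
  refine ⟨⟨fun z => if h : z = A.erased x then y.1 else f ⟨z.1, hz z h⟩, fun z z' h => ?_⟩,
    Function.Embedding.ext fun z => ?_, dif_pos rfl⟩
  · dsimp only at h
    split_ifs at h with h₁ h₂ h₂
    · rw [h₁, h₂]
    · exact (y.2 ⟨_, h.symm⟩).elim
    · exact (y.2 ⟨_, h⟩).elim
    · exact Subtype.ext (congrArg (fun u : FI.compl A.1 => u.1) (f.injective h))
  · exact dif_neg (A.complErase_ne x z)

/-- The Koszul differential corresponds to the differential of `S^*(W) ⊗ Λ^*(V) ⊗ S^*(W ⊗ V)`: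
extensions of `f` to `x` correspond to indices outside the image of `f`. -/
theorem evalMap_koszulD (A : Sub (n + 1) X) (ω : ExtPow k (A.1 →₀ k) (n + 1))
    (f : FI.compl A.1 ↪ B) (w : B → W) (v : X → V) :
    evalMap V W n X B (koszulD n ((homTr k).obj B) X (koszulGen A ω f))
      (PiTensorProduct.tprod k w) (PiTensorProduct.tprod k v) =
    symExtD k V W n (genValue A f ω w v) := by
  classical
  let : Fintype {j : B // j ∉ Set.range f} := Fintype.ofFinite _
  rw [koszulD_koszulGen]
  simp only [map_sum, LinearMap.sum_apply, evalMap_koszulGen]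
  rw [genValue, symExtD_symExtMk, extCoprod_extMap_evalLin, symCoprod_symProd,
    TensorProduct.sum_tmul, map_sum]
  simp only [TensorProduct.sum_tmul, TensorProduct.tmul_sum, map_sum, regroupMul_tmul]
  rw [Finset.sum_comm]
  refine Finset.sum_congr rfl fun x _ => ?_
  have hm : ∀ f' ∈ (Set.toFinite {f' : FI.compl (A.erase x).1 ↪ B |
      (A.complErase x).trans f' = f}).toFinset, (A.complErase x).trans f' = f :=
    fun f' h => by simpa using h
  refine Finset.sum_bij (fun f' hf => ⟨f' (A.erased x), extend_erased_notMem (hm f' hf)⟩)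
    (fun _ _ => Finset.mem_univ _) ?_ ?_ ?_
  · intro f₁ h₁ f₂ h₂ h
    ext z
    rcases A.compl_erase_cases x z with rfl | ⟨z, rfl⟩
    · exact congrArg Subtype.val h
    · rw [extend_apply (hm _ h₁), extend_apply (hm _ h₂)]
  · intro y _
    obtain ⟨f', hf, hy⟩ := exists_extend A x f y
    exact ⟨f', by simpa using hf, Subtype.ext hy⟩
  · intro f' hf
    exact genValue_extend (hm f' hf) _ w v _ rfl

theorem evalSchur_koszulDiff (p : ℕ × ℕ) :
    evalSchur k V W n p.1 p.2 ∘ₗ schurPartMap (LinearMap.id : V →ₗ[k] V)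
      (LinearMap.id : W →ₗ[k] W) (Functor.whiskerLeft (homTr k) (koszulDiff k n)) p =
    symExtD k V W n ∘ₗ evalSchur k V W (n + 1) p.1 p.2 := by
  obtain ⟨a, b⟩ := p
  refine schurPart_ext fun A ω f w v => ?_
  rw [LinearMap.comp_apply, LinearMap.comp_apply, evalSchur_schurGen]
  refine Eq.trans ?_ (evalMap_koszulD (X := FB.fin a) (B := FB.fin b) A ω f w v)
  change evalMap V W n (FB.fin a) (FB.fin b)
    (koszulD n ((homTr k).obj (FB.fin b)) (FB.fin a) (koszulGen A ω f))
    (PiTensorProduct.map (fun _ => LinearMap.id) (PiTensorProduct.tprod k w))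
    (PiTensorProduct.map (fun _ => LinearMap.id) (PiTensorProduct.tprod k v)) = _
  rw [PiTensorProduct.map_id, PiTensorProduct.map_id]
  rfl

theorem evalTotal_koszulDiff (n : ℕ) :
    evalTotal k V W n ∘ₗ schurMap (LinearMap.id : V →ₗ[k] V) (LinearMap.id : W →ₗ[k] W)
      (Functor.whiskerLeft (homTr k) (koszulDiff k n)) =
    symExtD k V W n ∘ₗ evalTotal k V W (n + 1) := by
  refine DirectSum.linearMap_ext _ fun p => ?_
  have h := evalSchur_koszulDiff (k := k) (V := V) (W := W) (n := n) p
  refine LinearMap.ext fun z => ?_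
  have hz := DFunLike.congr_fun h z
  simp only [LinearMap.comp_apply, schurMap, DirectSum.lmap_lof, evalTotal,
    DirectSum.toModule_lof] at hz ⊢
  exact hz

end Differential

/-! ### Naturality -/

section Naturality

variable {k : Type u} [CommRing k] {V W V' W' : Type u} [AddCommGroup V] [Module k V]
  [AddCommGroup W] [Module k W] [AddCommGroup V'] [Module k V'] [AddCommGroup W'] [Module k W']
  {n : ℕ} {X B : FB}

theorem symExtMap_genValue (g : V →ₗ[k] V') (h : W →ₗ[k] W') (A : Sub n X)
    (f : FI.compl A.1 ↪ B) (ω : ExtPow k (A.1 →₀ k) n) (w : B → W) (v : X → V) :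
    symExtMap g h n (genValue A f ω w v) =
      genValue A f ω (fun j => h (w j)) fun x => g (v x) := by
  change symExtMk k V' W' n (symMap h _) (extMap n g _) (symMap (TensorProduct.map h g) _) = _
  have h₁ : g ∘ₗ evalLin v A = evalLin (fun x => g (v x)) A := by
    ext a : 2
    simp
  rw [symMap_symProd, symMap_symProd, ← LinearMap.comp_apply (extMap n g), ← extMap_comp, h₁]
  rfl

theorem evalTotal_natural (g : V →ₗ[k] V') (h : W →ₗ[k] W') (n : ℕ) :
    evalTotal k V' W' n ∘ₗ schurMap g h (𝟙 (koszulBimod k n)) =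
      symExtMap g h n ∘ₗ evalTotal k V W n := by
  refine DirectSum.linearMap_ext _ fun ⟨a, b⟩ => ?_
  refine schurPart_ext fun A ω f w v => ?_
  simp only [LinearMap.comp_apply, schurMap, DirectSum.lmap_lof, evalTotal,
    DirectSum.toModule_lof]
  rw [evalSchur_schurGen]
  refine Eq.trans ?_ (symExtMap_genValue (X := FB.fin a) (B := FB.fin b) g h A f ω w v).symm
  refine Eq.trans ?_ (evalMap_koszulGen (X := FB.fin a) (B := FB.fin b) A ω f
    (fun j => h (w j)) fun x => g (v x))
  change evalMap V' W' n (FB.fin a) (FB.fin b) (koszulGen A ω f)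
    (PiTensorProduct.map (fun _ => h) (PiTensorProduct.tprod k w))
    (PiTensorProduct.map (fun _ => g) (PiTensorProduct.tprod k v)) = _
  exact congrArg₂ (fun x y => evalMap V' W' n (FB.fin a) (FB.fin b) (koszulGen A ω f) x y)
    (PiTensorProduct.map_tprod _ _) (PiTensorProduct.map_tprod _ _)

end Naturality

/-! ### Bidegrees and surjectivity -/

section Bidegree

variable {k : Type u} [CommRing k]

theorem symProd_cons {Z : Type u} [AddCommGroup Z] [Module k Z] {i : ℕ} (z : Fin (i + 1) → Z) :
    symProd (k := k) z =
      SymmetricAlgebra.ι k Z (z 0) * symProd (k := k) fun l : Fin i => z l.succ := by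
  rw [symProd_eq_prod, symProd_eq_prod, Fin.prod_univ_succ]

theorem symProd_mem_symPow {Z : Type u} [AddCommGroup Z] [Module k Z] {ι : Type*} [Finite ι]
    (z : ι → Z) : symProd (k := k) z ∈ symPow k Z (Nat.card ι) := by
  have key : ∀ (m : ℕ) (y : Fin m → Z), symProd (k := k) y ∈ symPow k Z m := by
    intro m
    induction m with
    | zero =>
      intro y
      rw [symProd_eq_prod, Finset.univ_eq_empty, Finset.prod_empty, symPow, pow_zero]
      exact Submodule.one_le.1 le_rfl
    | succ m ih =>
      intro y
      rw [symProd_cons, symPow, pow_succ']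
      exact Submodule.mul_mem_mul ⟨_, rfl⟩ (ih _)
  rw [← symProd_comp_equiv (Finite.equivFin ι).symm]
  exact key _ _

/-- If `S` spans `Z`, the products of `i` elements of `S` span `S^i(Z)`. -/
theorem symPow_le_span {Z : Type u} [AddCommGroup Z] [Module k Z] {S : Set Z}
    (hS : Submodule.span k S = ⊤) (i : ℕ) :
    symPow k Z i ≤ Submodule.span k {s | ∃ z : Fin i → Z, (∀ l, z l ∈ S) ∧ s = symProd z} := by
  have h : LinearMap.range (SymmetricAlgebra.ι k Z) =
      Submodule.span k (SymmetricAlgebra.ι k Z '' S) := by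
    rw [← Submodule.map_span, hS, LinearMap.range_eq_map]
  rw [symPow, h, Submodule.span_pow]
  refine Submodule.span_mono fun s hs => ?_
  obtain ⟨g, rfl⟩ := Set.mem_pow.1 hs
  choose z hz hz' using fun l => (g l).2
  refine ⟨z, hz, ?_⟩
  rw [symProd_eq_prod, List.prod_ofFn]
  simp [hz']

theorem span_iUnion_symPow (Z : Type u) [AddCommGroup Z] [Module k Z] :
    Submodule.span k (⋃ i, (symPow k Z i : Set (SymmetricAlgebra k Z))) = ⊤ := by
  refine eq_top_iff.2 fun s _ => ?_
  induction s using sym_induction with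
  | one => exact Submodule.subset_span (Set.mem_iUnion.2 ⟨0, Submodule.one_le.1 le_rfl⟩)
  | add s t hs ht => exact add_mem (hs trivial) (ht trivial)
  | smul c s hs => exact Submodule.smul_mem _ _ (hs trivial)
  | mul z s hs =>
    have h := hs trivial
    have : Submodule.span k (⋃ i, (symPow k Z i : Set (SymmetricAlgebra k Z))) ≤
        (Submodule.span k (⋃ i, (symPow k Z i : Set (SymmetricAlgebra k Z)))).comap
          (LinearMap.mulLeft k (SymmetricAlgebra.ι k Z z)) := by
      refine Submodule.span_le.2 fun t ht => ?_
      obtain ⟨i, hi⟩ := Set.mem_iUnion.1 ht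
      refine Submodule.subset_span (Set.mem_iUnion.2 ⟨i + 1, ?_⟩)
      change _ ∈ symPow k Z (i + 1)
      rw [symPow, pow_succ']
      exact Submodule.mul_mem_mul ⟨_, rfl⟩ hi
    exact this h

variable {V W : Type u} [AddCommGroup V] [Module k V] [AddCommGroup W] [Module k W] {n : ℕ}

theorem span_wedge : Submodule.span k (Set.range (wedge k V n)) = ⊤ :=
  exteriorPower.ιMulti_span k n V

/-- A submodule contains the pure tensors of three submodules as soon as it contains those of
spanning elements. -/
theorem symExtMk_mem {R : Submodule k (SymExtTerm k V W n)} {S : Set (SymmetricAlgebra k W)}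
    {L : Set (ExtPow k V n)} {T : Set (SymmetricAlgebra k (W ⊗[k] V))}
    (h : ∀ s ∈ S, ∀ η ∈ L, ∀ p ∈ T, symExtMk k V W n s η p ∈ R) {s η p}
    (hs : s ∈ Submodule.span k S) (hη : η ∈ Submodule.span k L) (hp : p ∈ Submodule.span k T) :
    symExtMk k V W n s η p ∈ R := by
  induction hs using Submodule.span_induction with
  | zero => simp
  | add x y _ _ hx hy => simpa using add_mem hx hy
  | smul c x _ hx => simpa using R.smul_mem c hx
  | mem s hs =>
  induction hη using Submodule.span_induction with
  | zero => simp
  | add x y _ _ hx hy => simpa using add_mem hx hy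
  | smul c x _ hx => simpa using R.smul_mem c hx
  | mem η hη =>
  induction hp using Submodule.span_induction with
  | zero => simp
  | add x y _ _ hx hy => simpa using add_mem hx hy
  | smul c x _ hx => simpa using R.smul_mem c hx
  | mem p hp => exact h s hs η hη p hp

theorem Sub.card_compl {X : FB} (A : Sub n X) : Nat.card (FI.compl A.1) + n = Nat.card X := by
  classical
  have h : Nat.card {x // x ∈ A.1} = n := (Nat.card_eq_card_toFinset _).trans (by simp [A.2])
  refine (congrArg (Nat.card (FI.compl A.1) + ·) h.symm).trans ?_
  rw [add_comm, ← Nat.card_sum]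
  exact Nat.card_congr (Equiv.sumCompl fun x => x ∈ A.1)

theorem card_notMem_range {ι κ : Type*} [Finite ι] [Finite κ] (f : ι ↪ κ) :
    Nat.card {j // j ∉ Set.range f} + Nat.card ι = Nat.card κ := by
  classical
  rw [Nat.card_congr (Equiv.ofInjective f f.injective), add_comm,
    ← Nat.card_sum]
  exact Nat.card_congr (Equiv.sumCompl fun j => j ∈ Set.range f)

theorem genValue_mem_symExtBideg {a b : ℕ} (A : Sub n (FB.fin a)) (f : FI.compl A.1 ↪ FB.fin b)
    (ω : ExtPow k (A.1 →₀ k) n) (w : FB.fin b → W) (v : FB.fin a → V) :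
    genValue A f ω w v ∈ symExtBideg k V W n a b := by
  have h₁ := A.card_compl
  have h₂ := card_notMem_range f
  have ha : Nat.card (FB.fin a) = a := Nat.card_fin a
  have hb : Nat.card (FB.fin b) = b := Nat.card_fin b
  exact Submodule.subset_span ⟨_, _, by omega, by omega, _, symProd_mem_symPow _, _, _,
    symProd_mem_symPow _, rfl⟩

/-- Every product of vectors is a value of `genValue`. -/
theorem exists_genValue_eq {i j : ℕ} {X B : FB} (eX : Fin n ⊕ Fin j ≃ X)
    (eB : Fin i ⊕ Fin j ≃ B) (w : Fin i → W) (v : Fin n → V) (w' : Fin j → W) (v' : Fin j → V) :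
    ∃ (A : Sub n X) (f : FI.compl A.1 ↪ B) (ω : ExtPow k (A.1 →₀ k) n) (β : B → W) (α : X → V),
      genValue A f ω β α = symExtMk k V W n (symProd w) (wedge k V n v)
        (symProd fun l => w' l ⊗ₜ v' l) := by
  classical
  -- The first block of `X` is `A`, and `f` identifies the second blocks of `X` and `B`.
  let A : Sub n X := ⟨Finset.univ.map (Function.Embedding.inl.trans eX.toEmbedding), by simp⟩
  have hA : ∀ x, x ∈ A.1 ↔ ∃ l, eX (Sum.inl l) = x := fun x => by simp [A]
  have hA' : ∀ l, eX (Sum.inr l) ∉ A.1 := fun l h => by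
    obtain ⟨l', hl⟩ := (hA _).1 h
    simpa using eX.injective hl
  let E : Fin j → FI.compl A.1 := fun l => ⟨eX (Sum.inr l), hA' l⟩
  have hE : Function.Bijective E := by
    refine ⟨fun l l' h => ?_, fun z => ?_⟩
    · exact Sum.inr_injective (eX.injective (congrArg (fun z : FI.compl A.1 => z.1) h))
    · obtain ⟨l | l, hl⟩ := eX.surjective z.1
      · exact (z.2 ((hA _).2 ⟨l, hl⟩)).elim
      · exact ⟨l, Subtype.ext hl⟩
  let E' : Fin j ≃ FI.compl A.1 := Equiv.ofBijective E hE
  let f : FI.compl A.1 ↪ B := E'.symm.toEmbedding.trans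
    (Function.Embedding.inr.trans eB.toEmbedding)
  have hf : ∀ l, f (E' l) = eB (Sum.inr l) := fun l => by simp [f]
  let G : Fin i → {y : B // y ∉ Set.range f} := fun l => ⟨eB (Sum.inl l), by
    rintro ⟨z, hz⟩
    obtain ⟨l', rfl⟩ := E'.surjective z
    rw [hf] at hz
    simpa using eB.injective hz⟩
  have hG : Function.Bijective G := by
    refine ⟨fun l l' h => Sum.inl_injective (eB.injective (congrArg Subtype.val h)), fun z => ?_⟩
    obtain ⟨l | l, hl⟩ := eB.surjective z.1
    · exact ⟨l, Subtype.ext hl⟩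
    · exact (z.2 ⟨E' l, (hf l).trans hl⟩).elim
  refine ⟨A, f, wedge k _ n fun l => Finsupp.single ⟨eX (Sum.inl l), (hA _).2 ⟨l, rfl⟩⟩ 1,
    fun y => Sum.elim w w' (eB.symm y), fun x => Sum.elim v v' (eX.symm x), ?_⟩
  unfold genValue
  rw [extMap_evalLin_wedge, ← symProd_comp_equiv (Equiv.ofBijective G hG),
    ← symProd_comp_equiv E']
  have h₁ : (fun l => Sum.elim w w' (eB.symm (Equiv.ofBijective G hG l).1)) = w := by
    ext l
    simp [G]
  have h₂ : (fun l => Sum.elim v v' (eX.symm (eX (Sum.inl l)))) = v := by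
    ext l
    simp
  have h₃ : (fun l => Sum.elim w w' (eB.symm (f (E' l))) ⊗ₜ[k]
      Sum.elim v v' (eX.symm (E' l).1)) = fun l => w' l ⊗ₜ[k] v' l := by
    ext l
    rw [hf]
    change _ ⊗ₜ[k] Sum.elim v v' (eX.symm (eX (Sum.inr l))) = _
    simp
  rw [h₁, h₂, h₃]

/-- The image of the bidegree `(a, b)` part of the source is the range of its evaluation map. -/
theorem map_lof_evalTotal (n a b : ℕ) :
    (LinearMap.range (DirectSum.lof k (ℕ × ℕ)
      (fun p => SchurPart V W (koszulBimod k n) p) (a, b))).map (evalTotal k V W n) =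
    LinearMap.range (evalSchur k V W n a b) := by
  rw [← LinearMap.range_comp]
  congr 1
  exact LinearMap.ext fun x => DirectSum.toModule_lof _ _ _

theorem range_evalSchur (n a b : ℕ) :
    LinearMap.range (evalSchur k V W n a b) = symExtBideg k V W n a b := by
  apply le_antisymm
  · suffices h : (symExtBideg k V W n a b).mkQ ∘ₗ evalSchur k V W n a b = 0 by
      rw [LinearMap.range_le_iff_comap]
      refine eq_top_iff.2 fun x _ => ?_
      simpa using DFunLike.congr_fun h x
    refine schurPart_ext fun A ω f w v => ?_
    rw [LinearMap.comp_apply, evalSchur_schurGen, LinearMap.zero_apply, Submodule.mkQ_apply,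
      Submodule.Quotient.mk_eq_zero]
    exact genValue_mem_symExtBideg A f ω w v
  · refine Submodule.span_le.2 ?_
    rintro _ ⟨i, j, hi, hj, s, hs, ω, p, hp, rfl⟩
    obtain rfl : n + j = a := by omega
    obtain rfl : i + j = b := by omega
    refine symExtMk_mem (fun s hs η hη p hp => ?_) (symPow_le_span (S := Set.univ)
      Submodule.span_univ i hs) (span_wedge (k := k) (V := V) (n := n) ▸ Submodule.mem_top)
      (symPow_le_span (TensorProduct.span_tmul_eq_top k W V) j hp)
    obtain ⟨w, -, rfl⟩ := hs
    obtain ⟨v, rfl⟩ := hη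
    obtain ⟨z, hz, rfl⟩ := hp
    choose w' v' hz' using hz
    obtain rfl : (fun l => w' l ⊗ₜ[k] v' l) = z := funext hz'
    obtain ⟨A, f, ω, β, α, h⟩ := exists_genValue_eq (k := k) (X := FB.fin (n + j))
      (B := FB.fin (i + j)) finSumFinEquiv finSumFinEquiv w v w' v'
    exact ⟨schurGen A ω f β α, (evalSchur_schurGen A ω f β α).trans h⟩

theorem evalTotal_surjective (n : ℕ) : Function.Surjective (evalTotal k V W n) := by
  rw [← LinearMap.range_eq_top]
  have h : ∀ a b, symExtBideg k V W n a b ≤ LinearMap.range (evalTotal k V W n) := fun a b => by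
    rw [← range_evalSchur]
    rintro _ ⟨x, rfl⟩
    exact ⟨DirectSum.lof k (ℕ × ℕ) (fun p => SchurPart V W (koszulBimod k n) p) (a, b) x,
      DirectSum.toModule_lof _ _ _⟩
  have key : ∀ s η p, symExtMk k V W n s η p ∈ LinearMap.range (evalTotal k V W n) :=
    fun s η p => by
      have hs : s ∈ Submodule.span k (⋃ i, (symPow k W i : Set (SymmetricAlgebra k W))) := by
        rw [span_iUnion_symPow]; trivial
      have hη : η ∈ Submodule.span k Set.univ := by rw [Submodule.span_univ]; trivial
      have hp : p ∈ Submodule.span k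
          (⋃ i, (symPow k (W ⊗[k] V) i : Set (SymmetricAlgebra k (W ⊗[k] V)))) := by
        rw [span_iUnion_symPow]; trivial
      refine symExtMk_mem (fun s hs η _ p hp => ?_) hs hη hp
      obtain ⟨i, hi⟩ := Set.mem_iUnion.1 hs
      obtain ⟨j, hj⟩ := Set.mem_iUnion.1 hp
      exact h (n + j) (i + j) (Submodule.subset_span
        ⟨i, j, by omega, by omega, s, hi, η, p, hj, rfl⟩)
  refine eq_top_iff.2 fun x _ => ?_
  induction x using TensorProduct.induction_on with
  | zero => exact zero_mem _
  | add x y hx hy => exact add_mem (hx trivial) (hy trivial)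
  | tmul s y =>
    induction y with
    | zero => rw [TensorProduct.tmul_zero]; exact zero_mem _
    | add x y hx hy => rw [TensorProduct.tmul_add]; exact add_mem (hx trivial) (hy trivial)
    | tmul η p => exact key s η p

end Bidegree

/-! ### Injectivity -/

section Injectivity

/-- A linear map which sends the elements of a spanning family to multiples of basis vectors is
injective if it kills only the zero elements of the family, and if the elements sent to multiples
of the same basis vector are proportional. -/
theorem injective_of_monomial {k ι Γ M N : Type*} [Field k] [AddCommGroup M] [Module k M]
    [AddCommGroup N] [Module k N] (x : ι → M)
    (hx : ∀ F G : M →ₗ[k] M, (∀ i, F (x i) = G (x i)) → F = G) (e : Module.Basis Γ k N)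
    (φ : M →ₗ[k] N) (R : ι → Γ → Prop)
    (h : ∀ i, x i = 0 ∨ ∃ γ, R i γ ∧ ∃ c : k, c ≠ 0 ∧ φ (x i) = c • e γ)
    (h' : ∀ i j γ, R i γ → R j γ → ∃ d : k, x i = d • x j) : Function.Injective φ := by
  classical
  let P : Γ → ι × k → Prop := fun γ q => R q.1 γ ∧ q.2 ≠ 0 ∧ φ (x q.1) = q.2 • e γ
  -- A left inverse: send a basis vector to the rescaled element of the family lying over it.
  let ψ : N →ₗ[k] M := e.constr k fun γ =>
    if hγ : ∃ q, P γ q then hγ.choose.2⁻¹ • x hγ.choose.1 else 0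
  have hψ : ψ ∘ₗ φ = LinearMap.id := by
    refine hx _ _ fun i => ?_
    rw [LinearMap.comp_apply, LinearMap.id_apply]
    rcases h i with h0 | ⟨γ, hR, c, hc, hφ⟩
    · rw [h0, map_zero, map_zero]
    have hγ : ∃ q, P γ q := ⟨(i, c), hR, hc, hφ⟩
    obtain ⟨hR', hc', hφ'⟩ := hγ.choose_spec
    obtain ⟨d, hd⟩ := h' i _ γ hR hR'
    have hcd : c = d * hγ.choose.2 := by
      rw [hd, map_smul, hφ', smul_smul] at hφ
      have := congrArg (fun z => e.repr z γ) hφ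
      simpa using this.symm
    rw [hφ, map_smul, Module.Basis.constr_basis, dif_pos hγ, smul_smul, hcd, mul_assoc,
      mul_inv_cancel₀ hc', mul_one, ← hd]
  exact Function.LeftInverse.injective (g := ψ) fun y => DFunLike.congr_fun hψ y

theorem exists_perm_of_range_eq {ι I : Type*} {u u' : ι → I} (hu : Function.Injective u)
    (hu' : Function.Injective u') (h : Set.range u = Set.range u') :
    ∃ π : Equiv.Perm ι, ∀ i, u' (π i) = u i := by
  refine ⟨(Equiv.ofInjective u hu).trans ((Equiv.setCongr h).trans
    (Equiv.ofInjective u' hu').symm), fun i => ?_⟩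
  exact congrArg Subtype.val ((Equiv.ofInjective u' hu').apply_symm_apply
    (Equiv.setCongr h (Equiv.ofInjective u hu i)))

/-- Two families with the same multiset of values differ by a bijection of the index sets. -/
theorem exists_equiv_of_sum_single_eq {ι ι' J : Type*} [Fintype ι] [Fintype ι'] (β : ι → J)
    (β' : ι' → J) (h : ∑ l, Finsupp.single (β l) 1 = ∑ l, Finsupp.single (β' l) 1) :
    ∃ e : ι ≃ ι', ∀ i, β' (e i) = β i := by
  classical
  have key : ∀ {κ : Type _} [Fintype κ] (b : κ → J) (q : J),
      (∑ l, Finsupp.single (b l) 1 : J →₀ ℕ) q = Fintype.card {l // b l = q} := by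
    intro κ _ b q
    simp [Finsupp.finsetSum_apply, Finsupp.single_apply, Fintype.card_subtype]
  have key' : ∀ (q : J),
      (∑ l, Finsupp.single (β' l) 1 : J →₀ ℕ) q = Fintype.card {l // β' l = q} := by
    intro q
    simp [Finsupp.finsetSum_apply, Finsupp.single_apply, Fintype.card_subtype]
  have hq : ∀ q, Nonempty ({l // β l = q} ≃ {l // β' l = q}) := fun q => by
    rw [← Fintype.card_eq, ← key, ← key', h]
  exact ⟨Equiv.ofFiberEquiv fun q => (hq q).some, fun i => Equiv.ofFiberEquiv_map _ i⟩

section SubtypeCongr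

variable {ι : Type*} {p q : ι → Prop} [DecidablePred p] [DecidablePred q]
  (e : {x // p x} ≃ {x // q x}) (f : {x // ¬p x} ≃ {x // ¬q x})

theorem subtypeCongr_apply_of_pos (x : {x // p x}) : e.subtypeCongr f x.1 = (e x).1 := by
  simp [Equiv.subtypeCongr, Equiv.sumCompl_symm_apply_of_pos x.2]

theorem subtypeCongr_apply_of_neg (x : {x // ¬p x}) : e.subtypeCongr f x.1 = (f x).1 := by
  simp [Equiv.subtypeCongr, Equiv.sumCompl_symm_apply_of_neg x.2]

end SubtypeCongr

section CommRing

variable {k : Type u} [CommRing k]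

theorem symProd_basis {Z : Type u} [AddCommGroup Z] [Module k Z] {J : Type*}
    (e : Module.Basis J k Z) {ι : Type*} [Fintype ι] (β : ι → J) :
    symProd (k := k) (fun l => e (β l)) = e.symmetricAlgebra (∑ l, Finsupp.single (β l) 1) := by
  rw [symProd_eq_prod]
  refine (SymmetricAlgebra.equivMvPolynomial e).injective ?_
  simp only [map_prod, SymmetricAlgebra.equivMvPolynomial_ι_apply, Module.Basis.symmetricAlgebra,
    Module.Basis.map_apply, MvPolynomial.coe_basisMonomials, AlgEquiv.toLinearEquiv_apply,
    AlgEquiv.apply_symm_apply, MvPolynomial.X]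
  exact (MvPolynomial.monomial_sum_one _ _).symm

variable {V W : Type u} [AddCommGroup V] [Module k V] [AddCommGroup W] [Module k W] {n : ℕ}

/-- The basis of `Λ^n(V)` given by the products of basis vectors in increasing order. -/
def extBasis {I : Type*} [LinearOrder I] (e : Module.Basis I k V) (n : ℕ) :
    Module.Basis (Set.powersetCard I n) k (ExtPow k V n) :=
  e.exteriorPower n

/-- A product of distinct basis vectors is, up to sign, a basis vector of `Λ^n(V)`. -/
theorem wedge_basis {I : Type*} [LinearOrder I] (e : Module.Basis I k V) (u : Fin n → I)
    (hu : Function.Injective u) (s : Set.powersetCard I n) (hs : ∀ i, i ∈ s ↔ i ∈ Set.range u) :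
    ∃ ε : ℤˣ, wedge k V n (fun l => e (u l)) = ε • extBasis e n s := by
  obtain ⟨π, hπ⟩ := exists_perm_of_range_eq hu
    (Set.powersetCard.ofFinEmbEquiv.symm s).injective (by
      ext i
      rw [← hs]
      exact (Set.powersetCard.mem_range_ofFinEmbEquiv_symm_iff_mem s i).symm)
  refine ⟨Equiv.Perm.sign π, ?_⟩
  have h : extBasis e n s = wedge k V n fun l => e (Set.powersetCard.ofFinEmbEquiv.symm s l) :=
    exteriorPower.basis_apply k n e s
  rw [h, ← wedge_perm]
  congr 1
  ext l
  simp [hπ]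

/-- The basis of `S^*(W) ⊗ Λ^n(V) ⊗ S^*(W ⊗ V)` given by bases of `V` and `W`. -/
def symExtBasis {I J : Type*} [LinearOrder I] (eV : Module.Basis I k V) (eW : Module.Basis J k W)
    (n : ℕ) : Module.Basis ((J →₀ ℕ) × (Set.powersetCard I n × ((J × I) →₀ ℕ))) k
      (SymExtTerm k V W n) :=
  eW.symmetricAlgebra.tensorProduct
    ((extBasis eV n).tensorProduct (eW.tensorProduct eV).symmetricAlgebra)

theorem symExtBasis_apply {I J : Type*} [LinearOrder I] (eV : Module.Basis I k V)
    (eW : Module.Basis J k W) (m : J →₀ ℕ) (s : Set.powersetCard I n) (m' : (J × I) →₀ ℕ) :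
    symExtBasis eV eW n (m, s, m') = symExtMk k V W n (eW.symmetricAlgebra m) (extBasis eV n s)
      ((eW.tensorProduct eV).symmetricAlgebra m') := by
  rw [symExtMk_apply]
  exact (Module.Basis.tensorProduct_apply _ _ _ _).trans
    (congrArg _ (Module.Basis.tensorProduct_apply _ _ _ _))

/-- An enumeration of the elements of `A`. -/
def Sub.enum {X : FB} (A : Sub n X) : Fin n ≃ A.1 := (A.1.equivFinOfCardEq A.2).symm

/-- The product of the elements of `A`, a generator of `Λ^n(k A)`. -/
def Sub.top (k : Type u) [CommRing k] {X : FB} (A : Sub n X) : ExtPow k (A.1 →₀ k) n :=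
  wedge k _ n fun i => Finsupp.single (A.enum i) 1

theorem units_smul_eq {M : Type*} [AddCommGroup M] [Module k M] (ε : ℤˣ) (x : M) :
    ε • x = ((ε : ℤ) : k) • x := by
  rw [Units.smul_def, Int.cast_smul_eq_zsmul]

theorem schurGen_smul {a b : ℕ} (c : k) (A : Sub n (FB.fin a)) (ω : ExtPow k (A.1 →₀ k) n)
    (f : FI.compl A.1 ↪ FB.fin b) (w : Fin b → W) (v : Fin a → V) :
    schurGen A (c • ω) f w v = c • schurGen A ω f w v := by
  have h : bimodGen A (c • ω) f = c • bimodGen A ω f :=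
    (congrArg (koszulIncl n ((homTr k).obj (FB.fin b)) (FB.fin a) A)
      (TensorProduct.smul_tmul' c ω _).symm).trans (map_smul _ c _)
  rw [schurGen, h, ← TensorProduct.smul_tmul', TensorProduct.tmul_smul, map_smul]
  rfl

/-- Permuting the data of a generator, with the element of `Λ^n(k A)` given by the chosen
enumeration of `A`, changes it by a sign. -/
theorem schurGen_top_eq {a b : ℕ} (σ : FB.fin b ≃ FB.fin b) (τ : FB.fin a ≃ FB.fin a)
    (π : Equiv.Perm (Fin n)) {A A' : Sub n (FB.fin a)}
    (hA : ∀ i, τ (A.enum i).1 = (A'.enum (π i)).1)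
    {f : FI.compl A.1 ↪ FB.fin b} {f' : FI.compl A'.1 ↪ FB.fin b}
    (hf : ∀ x y, τ x.1 = y.1 → f' y = σ (f x))
    {w w' : Fin b → W} (hw : ∀ j, w' (σ j) = w j) {v v' : Fin a → V} (hv : ∀ x, v' (τ x) = v x) :
    schurGen A (A.top k) f w v = Equiv.Perm.sign π • schurGen A' (A'.top k) f' w' v' := by
  classical
  have h : A.map τ = A' := by
    refine Subtype.ext (Finset.ext fun y => ?_)
    constructor
    · intro hy
      obtain ⟨x, hx, rfl⟩ := Finset.mem_map.1 hy
      obtain ⟨i, hi⟩ := A.enum.surjective ⟨x, hx⟩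
      have := hA i
      rw [hi] at this
      exact (show τ x = _ from this) ▸ (A'.enum (π i)).2
    · intro hy
      obtain ⟨i, hi⟩ := A'.enum.surjective ⟨y, hy⟩
      obtain ⟨j, rfl⟩ := π.surjective i
      have := hA j
      rw [hi] at this
      exact Finset.mem_map.2 ⟨_, (A.enum j).2, this⟩
  have hω : extMap n (Finsupp.lmapDomain k k τ ∘ₗ freeIncl A) (A.top k) =
      extMap n (freeIncl A') (Equiv.Perm.sign π • A'.top k) := by
    rw [Sub.top, Sub.top, ← wedge_perm, extMap_wedge, extMap_wedge]
    congr 1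
    ext i : 1
    simp only [Function.comp_apply, LinearMap.comp_apply, freeIncl_single, ← hA]
    simp
  rw [schurGen_eq σ τ h hω hf hw hv]
  rw [units_smul_eq (k := k), schurGen_smul, ← units_smul_eq]

end CommRing

variable {k : Type u} [Field k] {V W : Type u} [AddCommGroup V] [Module k V]
  [AddCommGroup W] [Module k W] {n : ℕ}

/-- The combinatorial data of a generator in which all vectors belong to fixed bases of `V` and
`W`, indexed by `I` and `J`. -/
structure GenDatum (n : ℕ) (I J : Type*) where
  (a b : ℕ)
  A : Sub n (FB.fin a)
  f : FI.compl A.1 ↪ FB.fin b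
  α : FB.fin a → I
  β : FB.fin b → J

namespace GenDatum

variable {I J : Type*} (eV : Module.Basis I k V) (eW : Module.Basis J k W)

/-- The generator of the Schur bifunctor with given data. -/
def gen (D : GenDatum n I J) : ⨁ p : ℕ × ℕ, SchurPart V W (koszulBimod k n) p :=
  DirectSum.lof k (ℕ × ℕ) (fun p => SchurPart V W (koszulBimod k n) p) (D.a, D.b)
    (schurGen D.A (D.A.top k) D.f (fun j => eW (D.β j)) fun x => eV (D.α x))

/-- The labels of the basis vectors indexed by `A`. -/
def ext (D : GenDatum n I J) : Fin n → I := fun i => D.α (D.A.enum i).1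

/-- The labels of the basis vectors indexed by the complement of the image of `f`. -/
def outer (D : GenDatum n I J) : {j : FB.fin D.b // j ∉ Set.range D.f} → J := fun j => D.β j.1

/-- The pairs of labels of basis vectors matched by `f`. -/
def matched (D : GenDatum n I J) : FI.compl D.A.1 → J × I := fun x => (D.β (D.f x), D.α x.1)

/-- The relation between a generator and the index of the basis vector to which it is sent, up to
sign. It requires the exterior part to have no repeated vector. -/
def IsLabel (D : GenDatum n I J) (γ : (J →₀ ℕ) × (Set.powersetCard I n × ((J × I) →₀ ℕ))) :
    Prop :=
  letI := Fintype.ofFinite {j : FB.fin D.b // j ∉ Set.range D.f}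
  letI := Fintype.ofFinite (FI.compl D.A.1)
  Function.Injective D.ext ∧ γ.1 = ∑ j, Finsupp.single (D.outer j) 1 ∧
    (∀ i, i ∈ γ.2.1 ↔ i ∈ Set.range D.ext) ∧ γ.2.2 = ∑ x, Finsupp.single (D.matched x) 1

/-- The generators built from basis vectors span the Schur bifunctor. -/
theorem hom_ext {N : Type*} [AddCommGroup N] [Module k N]
    {F G : (⨁ p : ℕ × ℕ, SchurPart V W (koszulBimod k n) p) →ₗ[k] N}
    (h : ∀ D : GenDatum n I J, F (D.gen eV eW) = G (D.gen eV eW)) : F = G := by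
  refine DirectSum.linearMap_ext _ fun ⟨a, b⟩ => ?_
  refine Representation.Coinvariants.hom_ext ?_
  refine TensorProduct.ext (PiTensorProduct.ext
    (Module.Basis.ext_multilinear (fun _ => eW) fun β => ?_))
  refine TensorProduct.ext (koszulSpace_ext (X := FB.fin a) (B := FB.fin b) fun A ω f => ?_)
  refine PiTensorProduct.ext (Module.Basis.ext_multilinear (fun _ => eV) fun α => ?_)
  have key : ∀ (H : (⨁ p : ℕ × ℕ, SchurPart V W (koszulBimod k n) p) →ₗ[k] N) (c : k),
      H (DirectSum.lof k (ℕ × ℕ) (fun p => SchurPart V W (koszulBimod k n) p) (a, b)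
        (schurGen A (c • A.top k) f (fun j => eW (β j)) fun x => eV (α x))) =
      c • H (gen eV eW ⟨a, b, A, f, α, β⟩) := by
    intro H c
    rw [← map_smul, gen, ← map_smul]
    exact congrArg (fun z => H (DirectSum.lof k (ℕ × ℕ) _ (a, b) z)) (schurGen_smul ..)
  obtain ⟨c, rfl⟩ := exists_smul_wedge_single A.enum ω
  exact (key F c).trans ((congrArg (c • ·) (h _)).trans (key G c).symm)

theorem evalTotal_gen (D : GenDatum n I J) : evalTotal k V W n (D.gen eV eW) =
    symExtMk k V W n (symProd fun j => eW (D.outer j)) (wedge k V n fun i => eV (D.ext i))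
      (symProd fun x => eW.tensorProduct eV (D.matched x)) := by
  rw [gen, evalTotal, DirectSum.toModule_lof]
  refine (evalSchur_schurGen _ _ _ _ _).trans ?_
  refine congrArg₂ (fun η p => symExtMk k V W n _ η p)
    (extMap_evalLin_wedge D.A D.A.enum fun x => eV (D.α x)) (congrArg _ (funext fun x => ?_))
  exact (Module.Basis.tensorProduct_apply eW eV _ _).symm

theorem evalTotal_gen_isLabel [LinearOrder I] (D : GenDatum n I J)
    (h : Function.Injective D.ext) : ∃ γ, D.IsLabel γ ∧
      ∃ c : k, c ≠ 0 ∧ evalTotal k V W n (D.gen eV eW) = c • symExtBasis eV eW n γ := by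
  classical
  let := Fintype.ofFinite {j : FB.fin D.b // j ∉ Set.range D.f}
  let := Fintype.ofFinite (FI.compl D.A.1)
  let s : Set.powersetCard I n := ⟨Finset.univ.image D.ext, by
    simp [Finset.card_image_of_injective _ h]⟩
  have hs : ∀ i, i ∈ s ↔ i ∈ Set.range D.ext := fun i => by
    rw [← Set.powersetCard.mem_coe_iff]; simp [s]
  obtain ⟨ε, hε⟩ := wedge_basis eV D.ext h s hs
  refine ⟨(∑ j, Finsupp.single (D.outer j) 1, s, ∑ x, Finsupp.single (D.matched x) 1),
    ⟨h, rfl, hs, rfl⟩, ((ε : ℤ) : k), by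
    rcases Int.units_eq_one_or ε with h | h <;> simp [h], ?_⟩
  rw [evalTotal_gen, symProd_basis, symProd_basis, hε, symExtBasis_apply,
    units_smul_eq (k := k), map_smul, LinearMap.smul_apply]

/-- A repeated basis vector in the exterior part makes a generator equal to its own opposite. -/
theorem gen_eq_zero [CharZero k] (D : GenDatum n I J) (h : ¬Function.Injective D.ext) :
    D.gen eV eW = 0 := by
  classical
  obtain ⟨a, b, A, f, α, β⟩ := D
  simp only [Function.Injective, not_forall] at h
  obtain ⟨p, q, hpq, hne⟩ := h
  have hA : ∀ i, Equiv.swap (A.enum p).1 (A.enum q).1 (A.enum i).1 =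
      (A.enum (Equiv.swap p q i)).1 := fun i => by
    rw [← Function.Injective.map_swap (f := fun i => (A.enum i).1)
      (Subtype.val_injective.comp A.enum.injective)]
  have key := schurGen_top_eq (k := k) (V := V) (W := W) (Equiv.refl (FB.fin b))
    (Equiv.swap (A.enum p).1 (A.enum q).1) (Equiv.swap p q) (A := A) (A' := A) hA (f := f)
    (f' := f) (fun x y hxy => by
      rw [Equiv.swap_apply_of_ne_of_ne] at hxy
      · exact congrArg f (Subtype.ext hxy.symm)
      · exact fun h => x.2 (h ▸ (A.enum p).2)
      · exact fun h => x.2 (h ▸ (A.enum q).2))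
    (w := fun j => eW (β j)) (w' := fun j => eW (β j)) (fun j => rfl)
    (v := fun x => eV (α x)) (v' := fun x => eV (α x)) (fun x => by
      congr 1
      rw [Equiv.swap_apply_def]
      split_ifs with h₁ h₂
      · rw [h₁]; exact hpq.symm
      · rw [h₂]; exact hpq
      · rfl)
  rw [Equiv.Perm.sign_swap hne, Units.neg_smul, one_smul, eq_neg_iff_add_eq_zero,
    ← two_smul k, smul_eq_zero] at key
  rw [gen, key.resolve_left two_ne_zero, map_zero]

/-- Generators sent to multiples of the same basis vector differ by permutations, hence by a
sign. -/
theorem gen_proportional (D D' : GenDatum n I J)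
    {γ : (J →₀ ℕ) × (Set.powersetCard I n × ((J × I) →₀ ℕ))} (h : D.IsLabel γ)
    (h' : D'.IsLabel γ) : ∃ c : k, D.gen eV eW = c • D'.gen eV eW := by
  classical
  let := Fintype.ofFinite {j : FB.fin D.b // j ∉ Set.range D.f}
  let := Fintype.ofFinite (FI.compl D.A.1)
  let := Fintype.ofFinite {j : FB.fin D'.b // j ∉ Set.range D'.f}
  let := Fintype.ofFinite (FI.compl D'.A.1)
  obtain ⟨h₁, h₂, h₃, h₄⟩ := h
  obtain ⟨h₁', h₂', h₃', h₄'⟩ := h'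
  -- Bijections between the indices outside the images of the injections, between the complements of
  -- the subsets, and between the subsets themselves, all compatible with the labels.
  obtain ⟨e₁, he₁⟩ := exists_equiv_of_sum_single_eq D.outer D'.outer (h₂.symm.trans h₂')
  obtain ⟨e₂, he₂⟩ := exists_equiv_of_sum_single_eq D.matched D'.matched (h₄.symm.trans h₄')
  obtain ⟨π, hπ⟩ := exists_perm_of_range_eq h₁ h₁'
    (Set.ext fun i => (h₃ i).symm.trans (h₃' i))
  clear h₁ h₂ h₃ h₄ h₁' h₂' h₃' h₄'
  have ha : D.a = D'.a := by
    have h₁ := D.A.card_compl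
    have h₂ := D'.A.card_compl
    rw [Nat.card_congr e₂, h₂] at h₁
    exact (Nat.card_fin _).symm.trans (h₁.symm.trans (Nat.card_fin _))
  have hb : D.b = D'.b := by
    have h₁ := card_notMem_range D.f
    have h₂ := card_notMem_range D'.f
    rw [Nat.card_congr e₁, Nat.card_congr e₂, h₂] at h₁
    exact (Nat.card_fin _).symm.trans (h₁.symm.trans (Nat.card_fin _))
  obtain ⟨a, b, A, f, α, β⟩ := D
  obtain ⟨a', b', A', f', α', β'⟩ := D'
  dsimp only at ha hb
  subst ha hb
  dsimp only [outer, matched, ext] at *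
  -- They assemble to permutations `τ` of the source and `σ` of the target.
  let τ : FB.fin a ≃ FB.fin a :=
    Equiv.subtypeCongr (p := fun x => x ∈ A.1) (q := fun x => x ∈ A'.1)
      (A.enum.symm.trans (π.trans A'.enum)) e₂
  let ef : {j // j ∈ Set.range f} ≃ {j // j ∈ Set.range f'} :=
    (Equiv.ofInjective f f.injective).symm.trans (e₂.trans (Equiv.ofInjective f' f'.injective))
  let σ : FB.fin b ≃ FB.fin b :=
    Equiv.subtypeCongr (p := fun x => x ∈ Set.range f) (q := fun x => x ∈ Set.range f') ef e₁
  have hτ : ∀ i, τ (A.enum i).1 = (A'.enum (π i)).1 := fun i =>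
    (subtypeCongr_apply_of_pos _ _ (A.enum i)).trans (by simp)
  have hτ' : ∀ x : FI.compl A.1, τ x.1 = (e₂ x).1 := fun x => subtypeCongr_apply_of_neg _ _ x
  have hσ : ∀ x, σ (f x) = f' (e₂ x) := fun x =>
    (subtypeCongr_apply_of_pos _ _ (Equiv.ofInjective f f.injective x)).trans (by simp [ef])
  have hσ' : ∀ j : {j // j ∉ Set.range f}, σ j.1 = (e₁ j).1 := fun j =>
    subtypeCongr_apply_of_neg _ _ j
  have key := schurGen_top_eq (k := k) (V := V) (W := W) σ τ π hτ (f := f) (f' := f')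
    (fun x y hxy => by
      rw [hσ]
      exact congrArg f' (Subtype.ext (hxy.symm.trans (hτ' x))))
    (w := fun j => eW (β j)) (w' := fun j => eW (β' j)) (fun j => by
      congr 1
      by_cases hj : j ∈ Set.range f
      · obtain ⟨x, rfl⟩ := hj
        rw [hσ]
        exact congrArg Prod.fst (he₂ x)
      · rw [hσ' ⟨j, hj⟩]
        exact he₁ ⟨j, hj⟩)
    (v := fun x => eV (α x)) (v' := fun x => eV (α' x)) (fun x => by
      congr 1
      by_cases hx : x ∈ A.1
      · obtain ⟨i, hi⟩ := A.enum.surjective ⟨x, hx⟩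
        have hx' : x = (A.enum i).1 := congrArg Subtype.val hi.symm
        rw [hx', hτ]
        exact hπ i
      · obtain ⟨x, rfl⟩ : ∃ x' : FI.compl A.1, x'.1 = x := ⟨⟨x, hx⟩, rfl⟩
        rw [hτ']
        exact congrArg Prod.snd (he₂ x))
  refine ⟨((Equiv.Perm.sign π : ℤ) : k), ?_⟩
  rw [gen, gen, key, ← map_smul, units_smul_eq (k := k)]

end GenDatum

theorem evalTotal_injective [CharZero k] (n : ℕ) : Function.Injective (evalTotal k V W n) := by
  classical
  let eV := Module.Basis.ofVectorSpace k V
  let eW := Module.Basis.ofVectorSpace k W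
  -- The basis of `Λ^n(V)` depends on an order of the basis of `V`; any one will do.
  let : LinearOrder (Module.Basis.ofVectorSpaceIndex k V) := linearOrderOfSTO WellOrderingRel
  refine injective_of_monomial (fun D : GenDatum n _ _ => D.gen eV eW)
    (fun F G h => GenDatum.hom_ext eV eW h) (symExtBasis eV eW n) (evalTotal k V W n)
    GenDatum.IsLabel (fun D => ?_) (fun D D' γ h h' => D.gen_proportional eV eW D' h h')
  by_cases h : Function.Injective D.ext
  · exact Or.inr (D.evalTotal_gen_isLabel eV eW h)
  · exact Or.inl (D.gen_eq_zero eV eW h)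

end Injectivity

/-! ### The isomorphism of complexes and the action on homology -/

section Iso

theorem schurKoszul_d (k : Type u) [CommRing k] (V W : Type u) [AddCommGroup V] [Module k V]
    [AddCommGroup W] [Module k W] (n : ℕ) : (schurKoszul k V W).d (n + 1) n =
      ModuleCat.ofHom (schurMap (LinearMap.id : V →ₗ[k] V) (LinearMap.id : W →ₗ[k] W)
        (Functor.whiskerLeft (homTr k) (koszulDiff k n))) := by
  change (schur V W).map ((koszulHom k).d (n + 1) n) = _
  have h : (koszulHom k).d (n + 1) n = Functor.whiskerLeft (homTr k) (koszulDiff k n) :=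
    ChainComplex.of_d (fun n => homTr k ⋙ koszulTerm k n)
      (fun n => Functor.whiskerLeft (homTr k) (koszulDiff k n)) n
  rw [h]
  rfl

theorem symExtComplex_d (k : Type u) [CommRing k] (V W : Type u) [AddCommGroup V] [Module k V]
    [AddCommGroup W] [Module k W] (n : ℕ) :
    (symExtComplex k V W).d (n + 1) n = ModuleCat.ofHom (symExtD k V W n) :=
  ChainComplex.of_d (fun n => ModuleCat.of k (SymExtTerm k V W n))
    (fun n => ModuleCat.ofHom (symExtD k V W n)) n

/-- The evaluation maps as an isomorphism of complexes. -/
def evalIso (k : Type u) [Field k] [CharZero k] (V W : Type u) [AddCommGroup V] [Module k V]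
    [AddCommGroup W] [Module k W] : schurKoszul k V W ≅ symExtComplex k V W :=
  HomologicalComplex.Hom.isoOfComponents
    (fun n => (LinearEquiv.ofBijective (evalTotal k V W n)
      ⟨evalTotal_injective n, evalTotal_surjective n⟩).toModuleIso)
    (by
      rintro _ n rfl
      rw [schurKoszul_d, symExtComplex_d]
      exact ModuleCat.hom_ext (evalTotal_koszulDiff (k := k) (V := V) (W := W) n).symm)

variable {k : Type u} [CommRing k] {V W : Type u} [AddCommGroup V] [Module k V]
  [AddCommGroup W] [Module k W]

/-- Multiplication by an element of `S^*(W ⊗ V)`, as an endomorphism of the complex. -/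
def symExtAct (s : SymmetricAlgebra k (W ⊗[k] V)) : symExtComplex k V W ⟶ symExtComplex k V W where
  f n := ModuleCat.ofHom (symAction k V W n s)
  comm' := by
    rintro _ n rfl
    rw [symExtComplex_d]
    exact ModuleCat.hom_ext (LinearMap.ext fun x => symExtD_smul n s x)

/-- The endomorphism of a complex isomorphic to `S^*(W) ⊗ Λ^*(V) ⊗ S^*(W ⊗ V)` given by
multiplication by an element of `S^*(W ⊗ V)`. -/
def transportAct {K : ChainComplex (ModuleCat.{u} k) ℕ} (Φ : K ≅ symExtComplex k V W)
    (s : SymmetricAlgebra k (W ⊗[k] V)) : K ⟶ K :=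
  Φ.hom ≫ symExtAct s ≫ Φ.inv

variable {K : ChainComplex (ModuleCat.{u} k) ℕ} (Φ : K ≅ symExtComplex k V W)

theorem transportAct_one : transportAct Φ 1 = 𝟙 K := by
  have h : symExtAct (1 : SymmetricAlgebra k (W ⊗[k] V)) = 𝟙 _ := by
    ext n : 1
    exact ModuleCat.hom_ext (map_one (symAction k V W n))
  rw [transportAct, h, Category.id_comp, Iso.hom_inv_id]

theorem transportAct_mul (s t : SymmetricAlgebra k (W ⊗[k] V)) :
    transportAct Φ (s * t) = transportAct Φ t ≫ transportAct Φ s := by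
  have h : symExtAct (s * t) = symExtAct t ≫ symExtAct s := by
    ext n : 1
    exact ModuleCat.hom_ext (map_mul (symAction k V W n) s t)
  simp [transportAct, h]

theorem transportAct_add (s t : SymmetricAlgebra k (W ⊗[k] V)) :
    transportAct Φ (s + t) = transportAct Φ s + transportAct Φ t := by
  have h : symExtAct (s + t) = symExtAct s + symExtAct t := by
    ext n : 1
    exact ModuleCat.hom_ext (map_add (symAction k V W n) s t)
  simp [transportAct, h]

theorem transportAct_zero : transportAct Φ 0 = 0 := by
  simpa using transportAct_add Φ 0 0

/-- The action of `S^*(W ⊗ V)` on homology induced by an isomorphism of complexes. -/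
@[reducible]
def homologyModule (n : ℕ) : Module (SymmetricAlgebra k (W ⊗[k] V)) (K.homology n) where
  smul s h := HomologicalComplex.homologyMap (transportAct Φ s) n h
  one_smul h := by
    change HomologicalComplex.homologyMap (transportAct Φ 1) n h = h
    rw [transportAct_one, HomologicalComplex.homologyMap_id]
    rfl
  mul_smul s t h := by
    change HomologicalComplex.homologyMap (transportAct Φ (s * t)) n h = _
    rw [transportAct_mul, HomologicalComplex.homologyMap_comp]
    rfl
  smul_zero s := map_zero (HomologicalComplex.homologyMap (transportAct Φ s) n).hom
  smul_add s := map_add (HomologicalComplex.homologyMap (transportAct Φ s) n).hom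
  add_smul s t h := by
    change HomologicalComplex.homologyMap (transportAct Φ (s + t)) n h = _
    rw [transportAct_add, HomologicalComplex.homologyMap_add]
    rfl
  zero_smul h := by
    change HomologicalComplex.homologyMap (transportAct Φ 0) n h = _
    rw [transportAct_zero, HomologicalComplex.homologyMap_zero]
    rfl

theorem transportAct_f_apply (s : SymmetricAlgebra k (W ⊗[k] V)) (n : ℕ) (y : K.X n)
    (x : SymExtTerm k V W n) (hx : Φ.hom.f n y = x) :
    Φ.hom.f n ((transportAct Φ s).f n y) = s • x := by
  have h : (transportAct Φ s).f n ≫ Φ.hom.f n = Φ.hom.f n ≫ (symExtAct s).f n := by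
    rw [← HomologicalComplex.comp_f, ← HomologicalComplex.comp_f]
    simp [transportAct]
  have h' := congrArg (fun g => g y) (congrArg ModuleCat.Hom.hom h)
  subst hx
  exact h'

/-- The class of the cycle corresponding to `s • x` is `s` times the class of the cycle
corresponding to `x`. -/
theorem homologyπ_eq_smul (n : ℕ) (s : SymmetricAlgebra k (W ⊗[k] V)) (z w : K.cycles n)
    (x : SymExtTerm k V W n) (hz : Φ.hom.f n (K.iCycles n z) = x)
    (hw : Φ.hom.f n (K.iCycles n w) = s • x) :
    K.homologyπ n w = (homologyModule Φ n).smul s (K.homologyπ n z) := by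
  have hi : Function.Injective (K.iCycles n) := (ModuleCat.mono_iff_injective _).1 inferInstance
  have hf : Function.Injective (Φ.hom.f n) := (ModuleCat.mono_iff_injective _).1 inferInstance
  have h₁ : w = HomologicalComplex.cyclesMap (transportAct Φ s) n z := by
    refine hi (hf (hw.trans ?_))
    have := congrArg (fun g => g z) (congrArg ModuleCat.Hom.hom
      (HomologicalComplex.cyclesMap_i (transportAct Φ s) n))
    refine (transportAct_f_apply Φ s n _ x hz).symm.trans (congrArg (Φ.hom.f n) this.symm)
  rw [h₁]
  exact congrArg (fun g => g z) (congrArg ModuleCat.Hom.hom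
    (HomologicalComplex.homologyπ_naturality (transportAct Φ s) n)).symm

theorem homologyModule_isScalarTower (n : ℕ) :
    letI := homologyModule Φ n
    IsScalarTower k (SymmetricAlgebra k (W ⊗[k] V)) (K.homology n) := by
  let := homologyModule Φ n
  refine ⟨fun c s h => ?_⟩
  obtain ⟨z, rfl⟩ : ∃ z, K.homologyπ n z = h :=
    (ModuleCat.epi_iff_surjective (K.homologyπ n)).1 inferInstance h
  let w := HomologicalComplex.cyclesMap (transportAct Φ s) n z
  have hw : Φ.hom.f n (K.iCycles n w) = s • (show SymExtTerm k V W n from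
      Φ.hom.f n (K.iCycles n z)) := by
    have := congrArg (fun g => g z) (congrArg ModuleCat.Hom.hom
      (HomologicalComplex.cyclesMap_i (transportAct Φ s) n))
    exact (congrArg (Φ.hom.f n) this).trans (transportAct_f_apply Φ s n _ _ rfl)
  have h₁ := homologyπ_eq_smul Φ n s z w _ rfl hw
  have h₂ := homologyπ_eq_smul Φ n (c • s) z (c • w) _ rfl (by
    rw [map_smul, map_smul, hw]
    exact (smul_assoc c s (show SymExtTerm k V W n from Φ.hom.f n (K.iCycles n z))).symm)
  rw [map_smul, h₁] at h₂
  exact h₂.symm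

end Iso

end FIKoszul

end

theorem mainTheorem5 (k : Type u) [Field k] [CharZero k] :
    -- the differential of `S^*(W) ⊗ Λ^*(V) ⊗ S^*(W ⊗ V)` is `S^*(W ⊗ V)`-linear
    (∀ (V W : Type u) [AddCommGroup V] [Module k V] [FiniteDimensional k V]
      [AddCommGroup W] [Module k W] [FiniteDimensional k W] (n : ℕ)
      (s : SymmetricAlgebra k (W ⊗[k] V)) (x : SymExtTerm k V W (n + 1)),
      symExtD k V W n (s • x) = s • symExtD k V W n x) ∧
    -- the isomorphism of complexes
    ∃ Φ : ∀ (V W : Type u) [AddCommGroup V] [Module k V] [FiniteDimensional k V]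
        [AddCommGroup W] [Module k W] [FiniteDimensional k W],
        schurKoszul k V W ≅ symExtComplex k V W,
      -- it respects the polynomial bidegree
      (∀ (V W : Type u) [AddCommGroup V] [Module k V] [FiniteDimensional k V]
        [AddCommGroup W] [Module k W] [FiniteDimensional k W] (n a b : ℕ),
        (schurKoszulBideg k V W n a b).map ((Φ V W).hom.f n).hom = symExtBideg k V W n a b) ∧
      -- it is natural
      (∀ (V W V' W' : Type u) [AddCommGroup V] [Module k V] [FiniteDimensional k V]
        [AddCommGroup W] [Module k W] [FiniteDimensional k W]
        [AddCommGroup V'] [Module k V'] [FiniteDimensional k V']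
        [AddCommGroup W'] [Module k W'] [FiniteDimensional k W']
        (f : V →ₗ[k] V') (g : W →ₗ[k] W') (n : ℕ),
        schurKoszulMap k f g n ≫ (Φ V' W').hom.f n =
          (Φ V W).hom.f n ≫ ModuleCat.ofHom (symExtMap f g n)) ∧
      -- the homology of the Koszul complex carries the induced `S^*(W ⊗ V)`-module structure
      (∀ (V W : Type u) [AddCommGroup V] [Module k V] [FiniteDimensional k V]
        [AddCommGroup W] [Module k W] [FiniteDimensional k W] (n : ℕ),
        ∃ _ : Module (SymmetricAlgebra k (W ⊗[k] V)) ((schurKoszul k V W).homology n),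
          IsScalarTower k (SymmetricAlgebra k (W ⊗[k] V)) ((schurKoszul k V W).homology n) ∧
          ∀ (s : SymmetricAlgebra k (W ⊗[k] V)) (z w : (schurKoszul k V W).cycles n)
            (x : SymExtTerm k V W n),
            (Φ V W).hom.f n ((schurKoszul k V W).iCycles n z) = x →
            (Φ V W).hom.f n ((schurKoszul k V W).iCycles n w) = s • x →
            (schurKoszul k V W).homologyπ n w = s • (schurKoszul k V W).homologyπ n z) := by
  refine ⟨fun V W _ _ _ _ _ _ n s x => symExtD_smul n s x,
    fun V W _ _ _ _ _ _ => evalIso k V W, ?_, ?_, ?_⟩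
  · intro V W _ _ _ _ _ _ n a b
    exact (map_lof_evalTotal n a b).trans (range_evalSchur n a b)
  · intro V W V' W' _ _ _ _ _ _ _ _ _ _ _ _ f g n
    exact ModuleCat.hom_ext (evalTotal_natural f g n)
  · intro V W _ _ _ _ _ _ n
    exact ⟨homologyModule (evalIso k V W) n, homologyModule_isScalarTower _ n,
      fun s z w x hz hw => homologyπ_eq_smul _ n s z w x hz hw⟩
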